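/- Write points of the half-plane as $(\rho,z)$ and let $S\subset(0,\infty)\times\mathbb R$ be a bounded Lipschitz domain, $m\in\mathbb Z\setminus\{0\}$ and $s\ge 0$ an integer. Let $H^s$ (resp. $H^s_\rho$) be the space of functions on $S$ whose weak derivatives up to order $s$ lie in $L^2(S)$ (resp. in $L^2_\rho=L^2(S;\rho\,d\rho\,dz)$), with the usual norms, taken componentwise for vector fields. For $u$ scalar and $\mathbf u=(u_\rho,u_z,u_\theta)$ let, in the weak sense, $$\mathrm{grad}^m u=\Big(\partial_\rho u,\ \partial_z u,\ -\tfrac m\rho u\Big),\qquad \mathrm{curl}^m\mathbf u=\Big(-\tfrac m\rho u_z-\partial_zu_\theta,\ \tfrac1\rho\big(\partial_\rho(\rho u_\theta)+m u_\rho\big),\ \partial_zu_\rho-\partial_\rho u_z\Big),$$ $$\mathrm{div}^m\mathbf u=\tfrac1\rho\partial_\rho(\rho u_\rho)-\tfrac m\rho u_\theta+\partial_zu_z,$$ and let $H_\rho(\mathrm{grad}^m)$, $H_\rho(\mathrm{curl}^m)$, $H_\rho(\mathrm{div}^m)$ be the spaces of $L^2_\rho$ functions (fields) whose image under the operator is in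 $L^2_\rho$, with the graph norms $\big(\|\cdot\|_{L^2_\rho}^2+\|d^m\cdot\|_{L^2_\rho}^2\big)^{1/2}$. Put $$\eta_{m,0}u=\tfrac m\rho u,\quad \eta_{m,1}\mathbf u=\Big(\tfrac1\rho(mu_\rho+u_\theta),\tfrac m\rho u_z,u_\theta\Big),\quad \eta_{m,2}\mathbf u=\Big(u_\rho,u_z,\tfrac1\rho(mu_\theta-u_\rho)\Big),\quad \eta_{m,3}u=u .$$ With $\mathrm{curl}\,(v_\rho,v_z)=\partial_\rho v_z-\partial_zv_\rho$, $\mathrm{rot}\,v=(\partial_zv,-\partial_\rho v)$ and the planar $\mathrm{grad}$, $\mathrm{div}$, put $Z^0=H^1(S)$, $Z^1=H(\mathrm{curl};S)$, $Z^{1*}=H(\mathrm{div};S)$, $Z^2=L^2(S)$. A Cartesian discretization consists of finite-dimensional subspaces of these spaces and linear, $L^2$-stable projectors $\Pi^0,\Pi^1,\Pi^{1*},\Pi^2$ of $Z^0,Z^1,Z^{1*},Z^2$ onto them with $\Pi^1\mathrm{grad}=\mathrm{grad}\,\Pi^0$, $\Pi^2\mathrm{curl}=\mathrm{curl}\,\Pi^1$,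 $\Pi^{1*}\mathrm{rot}=\mathrm{rot}\,\Pi^0$, $\Pi^2\mathrm{div}=\mathrm{div}\,\Pi^{1*}$. It satisfies the estimates of order $s$ with mesh size $h>0$ and constant $C_0$ if $$\|u-\Pi^0u\|_{H^1}\le C_0h^s\|u\|_{H^{s+1}},\quad \|\mathbf u-\Pi^1\mathbf u\|_{H(\mathrm{curl})}\le C_0h^s\|\mathbf u\|_{H^s(\mathrm{curl})},$$ $$\|\mathbf u-\Pi^{1*}\mathbf u\|_{H(\mathrm{div})}\le C_0h^s\|\mathbf u\|_{H^s(\mathrm{div})},\quad \|u-\Pi^2u\|_{L^2}\le C_0h^s\|u\|_{H^s}$$ for all $u$, $\mathbf u$ for which the right-hand side is finite; here $H^s(\mathrm{curl})$, $H^s(\mathrm{div})$ consist of the fields in $H^s$ whose curl, resp. divergence, is in $H^s$, with the graph norm. Let $$\bar\Pi^0=\eta_{m,0}^{-1}\Pi^0\eta_{m,0},\quad \bar\Pi^1=\eta_{m,1}^{-1}(\Pi^1\times\Pi^0)\eta_{m,1},\quad \bar\Pi^2=\eta_{m,2}^{-1}(\Pi^{1*}\times\Pi^2)\eta_{m,2},\quad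 \bar\Pi^3=\eta_{m,3}^{-1}\Pi^2\eta_{m,3},$$ defined on the functions in $H_\rho(\mathrm{grad}^m)$, $H_\rho(\mathrm{curl}^m)$, $H_\rho(\mathrm{div}^m)$, $L^2_\rho$ whose images under $\eta_{m,0},\dots,\eta_{m,3}$ lie in $Z^0$, $Z^1\times Z^0$, $Z^{1*}\times Z^2$, $Z^2$ respectively. Then for every $C_0$ there is a constant $C>0$, depending only on $S,m,s,C_0$, such that for every Cartesian discretization that satisfies the estimates of order $s$ with mesh size $h>0$ and constant $C_0$ the following hold; in each case $u$ (or $\mathbf u$) lies in the domain of the projector $\bar\Pi^k$ and the error lies in the space whose norm is taken. 1. If $u\in H_\rho(\mathrm{grad}^m)$ and $\eta_{m,0}u,\ \eta_{m,1}(\mathrm{grad}^mu)\in H^{s+2}_\rho$, then $$\|u-\bar\Pi^0u\|_{H_\rho(\mathrm{grad}^m)}\le Ch^s\big(\|\eta_{m,0}u\|_{H^{s+2}_\rho}+\|\eta_{m,1}(\mathrm{grad}^mu)\|_{H^{s+2}_\rho}\big).$$ 2. If $\mathbf u\in H_\rho(\mathrm{curl}^m)$ and $\eta_{m,1}\mathbf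 u,\ \eta_{m,2}(\mathrm{curl}^m\mathbf u)\in H^{s+2}_\rho$, then $$\|\mathbf u-\bar\Pi^1\mathbf u\|_{H_\rho(\mathrm{curl}^m)}\le Ch^s\big(\|\eta_{m,1}\mathbf u\|_{H^{s+2}_\rho}+\|\eta_{m,2}(\mathrm{curl}^m\mathbf u)\|_{H^{s+2}_\rho}\big).$$ 3. If $\mathbf u\in H_\rho(\mathrm{div}^m)$ and $\eta_{m,2}\mathbf u,\ \eta_{m,3}(\mathrm{div}^m\mathbf u)\in H^{s+2}_\rho$, then $$\|\mathbf u-\bar\Pi^2\mathbf u\|_{H_\rho(\mathrm{div}^m)}\le Ch^s\big(\|\eta_{m,2}\mathbf u\|_{H^{s+2}_\rho}+\|\eta_{m,3}(\mathrm{div}^m\mathbf u)\|_{H^{s+2}_\rho}\big).$$ 4. If $u\in H^{s+2}_\rho$, then $\|u-\bar\Pi^3u\|_{L^2_\rho}\le Ch^s\|u\|_{H^{s+2}_\rho}$. -/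

import Mathlib

open MeasureTheory

noncomputable section

namespace Axisym

/-! ### The cross-section

Points of the meridian half-plane are pairs `p = (ρ, z) : ℝ × ℝ`. -/

/-- `S` is a bounded Lipschitz domain of the plane: open, connected, bounded, and near each
boundary point it is, after a rotation of the coordinate axes, the strict epigraph of a Lipschitz
function of one variable. -/
structure IsBoundedLipschitzDomain (S : Set (ℝ × ℝ)) : Prop where
  isOpen : IsOpen S
  isConnected : IsConnected S
  isBounded : Bornology.IsBounded S
  lipschitz_boundary : ∀ x ∈ frontier S, ∃ (t r : ℝ) (L : NNReal) (f : ℝ → ℝ),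
    0 < r ∧ LipschitzWith L f ∧ ∀ p ∈ Metric.ball x r,
      (p ∈ S ↔ f (Real.cos t * p.1 + Real.sin t * p.2) <
        -Real.sin t * p.1 + Real.cos t * p.2)

/-! ### Functions, norms and weak derivatives -/

/-- Real measurable functions on `S`, modulo equality almost everywhere. -/
abbrev Fn (S : Set (ℝ × ℝ)) : Type := (ℝ × ℝ) →ₘ[volume.restrict S] ℝ

/-- Lebesgue measure `dρ dz` on `S`. -/
abbrev cartMeasure (S : Set (ℝ × ℝ)) : Measure (ℝ × ℝ) := volume.restrict S

/-- The weighted measure `ρ dρ dz` on `S`. -/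
def rhoMeasure (S : Set (ℝ × ℝ)) : Measure (ℝ × ℝ) :=
  (volume.restrict S).withDensity fun p => ENNReal.ofReal p.1

/-- The `L²(μ)` norm (meaningful for functions in `L²(μ)`). -/
def l2Norm {S : Set (ℝ × ℝ)} (μ : Measure (ℝ × ℝ)) (u : Fn S) : ℝ := (eLpNorm u 2 μ).toReal

/-- The `L²(μ)` norm of a vector field, with the Euclidean norm on vectors. -/
def l2NormVec {S : Set (ℝ × ℝ)} {n : ℕ} (μ : Measure (ℝ × ℝ)) (u : Fin n → Fn S) : ℝ :=
  Real.sqrt (∑ i, l2Norm μ (u i) ^ 2)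

/-- `u ∈ L¹_loc(S)`. -/
def LocInt (S : Set (ℝ × ℝ)) (u : Fn S) : Prop :=
  ∀ K ⊆ S, IsCompact K → IntegrableOn u K

/-- Test functions: `φ ∈ C_c^∞(S)`. -/
structure IsTest (S : Set (ℝ × ℝ)) (φ : ℝ × ℝ → ℝ) : Prop where
  smooth : ContDiff ℝ ((⊤ : ℕ∞) : WithTop ℕ∞) φ
  compact : HasCompactSupport φ
  supp : tsupport φ ⊆ S

/-- The classical `∂φ/∂ρ`. -/
def pdRho (φ : ℝ × ℝ → ℝ) : ℝ × ℝ → ℝ := fun p => fderiv ℝ φ p (1, 0)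

/-- The classical `∂φ/∂z`. -/
def pdZ (φ : ℝ × ℝ → ℝ) : ℝ × ℝ → ℝ := fun p => fderiv ℝ φ p (0, 1)

/-- `g = ∂_ρ^a ∂_z^b u` in the weak sense on `S`. -/
def HasWeakDeriv (S : Set (ℝ × ℝ)) (a b : ℕ) (u g : Fn S) : Prop :=
  LocInt S u ∧ LocInt S g ∧ ∀ φ, IsTest S φ →
    ∫ p in S, u p * (pdRho^[a] (pdZ^[b] φ)) p = (-1) ^ (a + b) * ∫ p in S, g p * φ p

/-- `g = ∂_ρ f₀ + ∂_z f₁` in the weak sense on `S` (the two summands need not be functions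
separately). -/
def HasWeakDiv (S : Set (ℝ × ℝ)) (f : Fin 2 → Fn S) (g : Fn S) : Prop :=
  (∀ i, LocInt S (f i)) ∧ LocInt S g ∧ ∀ φ, IsTest S φ →
    ∫ p in S, (f 0 p * pdRho φ p + f 1 p * pdZ φ p) = - ∫ p in S, g p * φ p

/-- The weak derivative `∂_ρ^a ∂_z^b u`, when it exists (it is unique, see
`HasWeakDeriv.unique`). -/
def weakDeriv (S : Set (ℝ × ℝ)) (a b : ℕ) (u : Fn S) : Fn S :=
  Classical.epsilon (HasWeakDeriv S a b u)

/-- The weak divergence `∂_ρ f₀ + ∂_z f₁`, when it exists (it is unique, see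
`HasWeakDiv.unique`). -/
def weakDiv (S : Set (ℝ × ℝ)) (f : Fin 2 → Fn S) : Fn S :=
  Classical.epsilon (HasWeakDiv S f)

/-- The weak scalar curl `∂_ρ u_z - ∂_z u_ρ` of `u = (u_ρ, u_z)`. -/
def weakCurl (S : Set (ℝ × ℝ)) (u : Fin 2 → Fn S) : Fn S := weakDiv S ![u 1, - u 0]

/-- The weak gradient `(∂_ρ u, ∂_z u)`. -/
def weakGrad (S : Set (ℝ × ℝ)) (u : Fn S) : Fin 2 → Fn S :=
  ![weakDeriv S 1 0 u, weakDeriv S 0 1 u]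

/-- The rotor `(∂_z u, -∂_ρ u)`. -/
def weakRot (S : Set (ℝ × ℝ)) (u : Fn S) : Fin 2 → Fn S :=
  ![weakDeriv S 0 1 u, - weakDeriv S 1 0 u]

/-! Linearity and uniqueness of weak derivatives. -/

theorem LocInt.add {S : Set (ℝ × ℝ)} {u v : Fn S} (hu : LocInt S u) (hv : LocInt S v) :
    LocInt S (u + v) := fun K hK hc =>
  ((hu K hK hc).add (hv K hK hc)).congr
    (Filter.EventuallyEq.symm (ae_restrict_of_ae_restrict_of_subset hK (AEEqFun.coeFn_add u v)))

theorem LocInt.smul {S : Set (ℝ × ℝ)} {u : Fn S} (c : ℝ) (hu : LocInt S u) :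
    LocInt S (c • u) := fun K hK hc =>
  ((hu K hK hc).smul c).congr
    (Filter.EventuallyEq.symm (ae_restrict_of_ae_restrict_of_subset hK (AEEqFun.coeFn_smul c u)))

theorem LocInt.zero {S : Set (ℝ × ℝ)} : LocInt S (0 : Fn S) := fun K hK _ =>
  (integrable_zero (ℝ × ℝ) ℝ (volume.restrict K)).congr
    (Filter.EventuallyEq.symm
      (ae_restrict_of_ae_restrict_of_subset hK (AEEqFun.coeFn_zero (β := ℝ))))

theorem LocInt.integrable_mul {S : Set (ℝ × ℝ)} {u : Fn S} (hu : LocInt S u)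
    {ψ : ℝ × ℝ → ℝ} (hψ : IsTest S ψ) : IntegrableOn (fun p => u p * ψ p) S := by
  have h1 : IntegrableOn (fun p => u p * ψ p) (tsupport ψ) :=
    (hu _ hψ.supp hψ.compact).mul_continuousOn hψ.smooth.continuous.continuousOn hψ.compact
  have h2 : Integrable (fun p => u p * ψ p) := by
    rw [← integrableOn_iff_integrable_of_support_subset (s := tsupport ψ)]
    · exact h1
    · exact (Function.support_mul_subset_right _ _).trans (subset_tsupport _)
  exact h2.integrableOn

theorem IsTest.pd {S : Set (ℝ × ℝ)} {φ : ℝ × ℝ → ℝ} (hφ : IsTest S φ) (v : ℝ × ℝ) :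
    IsTest S (fun p => fderiv ℝ φ p v) := by
  refine ⟨?_, hφ.compact.fderiv_apply ℝ v, ?_⟩
  · have : ContDiff ℝ ((⊤ : ℕ∞) : WithTop ℕ∞) (fderiv ℝ φ) :=
      hφ.smooth.fderiv_right (by exact le_rfl)
    exact this.clm_apply contDiff_const
  · exact (tsupport_fderiv_apply_subset ℝ v).trans hφ.supp

theorem IsTest.iter {S : Set (ℝ × ℝ)} {φ : ℝ × ℝ → ℝ} (hφ : IsTest S φ) (a b : ℕ) :
    IsTest S (pdRho^[a] (pdZ^[b] φ)) := by
  have hz : IsTest S (pdZ^[b] φ) := by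
    induction b with
    | zero => exact hφ
    | succ b ih => rw [Function.iterate_succ_apply']; exact ih.pd _
  induction a with
  | zero => exact hz
  | succ a ih => rw [Function.iterate_succ_apply']; exact ih.pd _

theorem setIntegral_add_mul {S : Set (ℝ × ℝ)} {u v : Fn S} {ψ : ℝ × ℝ → ℝ}
    (hu : LocInt S u) (hv : LocInt S v) (hψ : IsTest S ψ) :
    ∫ p in S, (u + v) p * ψ p = (∫ p in S, u p * ψ p) + ∫ p in S, v p * ψ p := by
  rw [← integral_add (hu.integrable_mul hψ) (hv.integrable_mul hψ)]
  refine integral_congr_ae ?_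
  filter_upwards [AEEqFun.coeFn_add u v] with p hp
  rw [hp, Pi.add_apply, add_mul]

theorem setIntegral_smul_mul {S : Set (ℝ × ℝ)} (c : ℝ) (u : Fn S) (ψ : ℝ × ℝ → ℝ) :
    ∫ p in S, (c • u) p * ψ p = c * ∫ p in S, u p * ψ p := by
  rw [← integral_const_mul]
  refine integral_congr_ae ?_
  filter_upwards [AEEqFun.coeFn_smul c u] with p hp
  rw [hp, Pi.smul_apply, smul_eq_mul, mul_assoc]

theorem HasWeakDeriv.add {S : Set (ℝ × ℝ)} {a b : ℕ} {u v g k : Fn S}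
    (hu : HasWeakDeriv S a b u g) (hv : HasWeakDeriv S a b v k) :
    HasWeakDeriv S a b (u + v) (g + k) :=
  ⟨hu.1.add hv.1, hu.2.1.add hv.2.1, fun φ hφ => by
    rw [setIntegral_add_mul hu.1 hv.1 (hφ.iter a b), setIntegral_add_mul hu.2.1 hv.2.1 hφ,
      hu.2.2 φ hφ, hv.2.2 φ hφ, mul_add]⟩

theorem HasWeakDeriv.smul {S : Set (ℝ × ℝ)} {a b : ℕ} {u g : Fn S} (c : ℝ)
    (hu : HasWeakDeriv S a b u g) : HasWeakDeriv S a b (c • u) (c • g) :=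
  ⟨hu.1.smul c, hu.2.1.smul c, fun φ hφ => by
    rw [setIntegral_smul_mul, setIntegral_smul_mul, hu.2.2 φ hφ]; ring⟩

theorem HasWeakDeriv.zero {S : Set (ℝ × ℝ)} {a b : ℕ} :
    HasWeakDeriv S a b (0 : Fn S) 0 := by
  refine ⟨LocInt.zero, LocInt.zero, fun φ _ => ?_⟩
  have h := fun ψ => setIntegral_smul_mul (S := S) 0 0 ψ
  simp only [zero_smul, zero_mul] at h
  rw [h, h, mul_zero]

theorem setIntegral_pair {S : Set (ℝ × ℝ)} {f : Fin 2 → Fn S} (hf : ∀ i, LocInt S (f i))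
    {φ : ℝ × ℝ → ℝ} (hφ : IsTest S φ) :
    ∫ p in S, (f 0 p * pdRho φ p + f 1 p * pdZ φ p) =
      (∫ p in S, f 0 p * pdRho φ p) + ∫ p in S, f 1 p * pdZ φ p :=
  integral_add ((hf 0).integrable_mul (hφ.pd _)) ((hf 1).integrable_mul (hφ.pd _))

theorem HasWeakDiv.add {S : Set (ℝ × ℝ)} {f k : Fin 2 → Fn S} {g l : Fn S}
    (hf : HasWeakDiv S f g) (hk : HasWeakDiv S k l) : HasWeakDiv S (f + k) (g + l) := by
  have h : ∀ i, LocInt S ((f + k) i) := fun i => (hf.1 i).add (hk.1 i)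
  refine ⟨h, hf.2.1.add hk.2.1, fun φ hφ => ?_⟩
  have e1 := hf.2.2 φ hφ
  have e2 := hk.2.2 φ hφ
  rw [setIntegral_pair hf.1 hφ] at e1
  rw [setIntegral_pair hk.1 hφ] at e2
  rw [setIntegral_pair h hφ, setIntegral_add_mul hf.2.1 hk.2.1 hφ, Pi.add_apply, Pi.add_apply,
    setIntegral_add_mul (ψ := pdRho φ) (hf.1 0) (hk.1 0) (hφ.pd _),
    setIntegral_add_mul (ψ := pdZ φ) (hf.1 1) (hk.1 1) (hφ.pd _)]
  linarith

theorem HasWeakDiv.smul {S : Set (ℝ × ℝ)} {f : Fin 2 → Fn S} {g : Fn S} (c : ℝ)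
    (hf : HasWeakDiv S f g) : HasWeakDiv S (c • f) (c • g) := by
  have h : ∀ i, LocInt S ((c • f) i) := fun i => (hf.1 i).smul c
  refine ⟨h, hf.2.1.smul c, fun φ hφ => ?_⟩
  have e1 := hf.2.2 φ hφ
  rw [setIntegral_pair hf.1 hφ] at e1
  rw [setIntegral_pair h hφ, Pi.smul_apply, Pi.smul_apply, setIntegral_smul_mul,
    setIntegral_smul_mul, setIntegral_smul_mul, ← mul_add, e1, mul_neg]

theorem HasWeakDiv.zero {S : Set (ℝ × ℝ)} : HasWeakDiv S (0 : Fin 2 → Fn S) 0 := by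
  refine ⟨fun _ => LocInt.zero, LocInt.zero, fun φ hφ => ?_⟩
  have h := fun ψ => setIntegral_smul_mul (S := S) 0 0 ψ
  simp only [zero_smul, zero_mul] at h
  rw [setIntegral_pair (f := 0) (fun _ => LocInt.zero) hφ, Pi.zero_apply, Pi.zero_apply, h, h, h]
  simp

theorem eq_of_setIntegral_mul_eq {S : Set (ℝ × ℝ)} (hS : IsOpen S) {g k : Fn S}
    (hg : LocInt S g) (hk : LocInt S k)
    (h : ∀ φ, IsTest S φ → ∫ p in S, g p * φ p = ∫ p in S, k p * φ p) : g = k := by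
  have hloc : LocallyIntegrableOn (fun p => g p - k p) S := by
    rw [locallyIntegrableOn_iff hS.isLocallyClosed]
    exact fun K hK hc => (hg K hK hc).sub (hk K hK hc)
  have h0 := hS.ae_eq_zero_of_integral_contDiff_smul_eq_zero hloc (fun φ h1 h2 h3 => by
    have ht : IsTest S φ := ⟨h1, h2, h3⟩
    have e : ∀ p, φ p • (g p - k p) = g p * φ p - k p * φ p := fun p => by
      rw [smul_eq_mul]; ring
    simp only [e]
    rw [← setIntegral_eq_integral_of_forall_compl_eq_zero (s := S),
      integral_sub (hg.integrable_mul ht) (hk.integrable_mul ht), h φ ht, sub_self]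
    intro p hp
    have : φ p = 0 := image_eq_zero_of_notMem_tsupport fun hh => hp (h3 hh)
    simp [this])
  refine AEEqFun.ext ?_
  refine (ae_restrict_iff' hS.measurableSet).2 ?_
  filter_upwards [h0] with p hp hpS
  exact sub_eq_zero.1 (hp hpS)

theorem HasWeakDeriv.unique {S : Set (ℝ × ℝ)} (hS : IsOpen S) {a b : ℕ} {u g k : Fn S}
    (hg : HasWeakDeriv S a b u g) (hk : HasWeakDeriv S a b u k) : g = k :=
  eq_of_setIntegral_mul_eq hS hg.2.1 hk.2.1 fun φ hφ =>
    mul_left_cancel₀ (pow_ne_zero (a + b) (by norm_num : (-1 : ℝ) ≠ 0))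
      ((hg.2.2 φ hφ).symm.trans (hk.2.2 φ hφ))

theorem HasWeakDiv.unique {S : Set (ℝ × ℝ)} (hS : IsOpen S) {f : Fin 2 → Fn S} {g k : Fn S}
    (hg : HasWeakDiv S f g) (hk : HasWeakDiv S f k) : g = k :=
  eq_of_setIntegral_mul_eq hS hg.2.1 hk.2.1 fun φ hφ =>
    neg_injective ((hg.2.2 φ hφ).symm.trans (hk.2.2 φ hφ))

theorem memLp_add {S : Set (ℝ × ℝ)} {u v : Fn S} (hu : MemLp u 2 (cartMeasure S))
    (hv : MemLp v 2 (cartMeasure S)) : MemLp (u + v : Fn S) 2 (cartMeasure S) :=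
  (memLp_congr_ae (AEEqFun.coeFn_add u v)).2 (hu.add hv)

theorem memLp_smul {S : Set (ℝ × ℝ)} {u : Fn S} (c : ℝ) (hu : MemLp u 2 (cartMeasure S)) :
    MemLp (c • u : Fn S) 2 (cartMeasure S) :=
  (memLp_congr_ae (AEEqFun.coeFn_smul c u)).2 (hu.const_smul c)

theorem memLp_zero {S : Set (ℝ × ℝ)} : MemLp (0 : Fn S) 2 (cartMeasure S) :=
  (memLp_congr_ae (AEEqFun.coeFn_zero (β := ℝ))).2 MemLp.zero

/-! ### Sobolev spaces -/

/-- All weak derivatives of `u` of order at most `s` exist and lie in `L²(μ)`. With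
`μ = cartMeasure S` this is `u ∈ H^s(S)`, with `μ = rhoMeasure S` it is `u ∈ H_ρ^s(S)`. -/
def MemSob (S : Set (ℝ × ℝ)) (μ : Measure (ℝ × ℝ)) (s : ℕ) (u : Fn S) : Prop :=
  ∀ a b : ℕ, a + b ≤ s → ∃ g, HasWeakDeriv S a b u g ∧ MemLp g 2 μ

/-- The norm `(∑_{a+b ≤ s} ‖∂_ρ^a ∂_z^b u‖²_{L²(μ)})^{1/2}`. -/
def sobNorm (S : Set (ℝ × ℝ)) (μ : Measure (ℝ × ℝ)) (s : ℕ) (u : Fn S) : ℝ :=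
  Real.sqrt (∑ k ∈ Finset.range (s + 1), ∑ α ∈ Finset.HasAntidiagonal.antidiagonal k,
    l2Norm μ (weakDeriv S α.1 α.2 u) ^ 2)

/-- The Sobolev norm of a vector field. -/
def sobNormVec (S : Set (ℝ × ℝ)) (μ : Measure (ℝ × ℝ)) (s : ℕ) {n : ℕ} (u : Fin n → Fn S) : ℝ :=
  Real.sqrt (∑ i, sobNorm S μ s (u i) ^ 2)

/-! ### Cartesian spaces -/

/-- `Z⁰ = H¹(S)`. -/
def H1 (S : Set (ℝ × ℝ)) : Submodule ℝ (Fn S) where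
  carrier := {u | MemSob S (cartMeasure S) 1 u}
  add_mem' := fun hu hv a b hab => by
    obtain ⟨g, hg, hg'⟩ := hu a b hab
    obtain ⟨k, hk, hk'⟩ := hv a b hab
    exact ⟨g + k, hg.add hk, memLp_add hg' hk'⟩
  zero_mem' := fun _ _ _ => ⟨0, HasWeakDeriv.zero, memLp_zero⟩
  smul_mem' := fun c u hu a b hab => by
    obtain ⟨g, hg, hg'⟩ := hu a b hab
    exact ⟨c • g, hg.smul c, memLp_smul c hg'⟩

/-- `Z¹ = H(curl; S)`. -/
def Hcurl (S : Set (ℝ × ℝ)) : Submodule ℝ (Fin 2 → Fn S) where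
  carrier := {u | (∀ i, MemLp (u i) 2 (cartMeasure S)) ∧
    ∃ g, HasWeakDiv S ![u 1, - u 0] g ∧ MemLp g 2 (cartMeasure S)}
  add_mem' := by
    rintro u v ⟨hu, g, hg, hg'⟩ ⟨hv, k, hk, hk'⟩
    refine ⟨fun i => memLp_add (hu i) (hv i), g + k, ?_, memLp_add hg' hk'⟩
    convert hg.add hk using 1
    ext1 i
    fin_cases i
    · rfl
    · exact neg_add _ _
  zero_mem' := by
    refine ⟨fun _ => memLp_zero, 0, ?_, memLp_zero⟩
    convert HasWeakDiv.zero using 1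
    ext1 i
    fin_cases i
    · rfl
    · exact neg_zero
  smul_mem' := by
    rintro c u ⟨hu, g, hg, hg'⟩
    refine ⟨fun i => memLp_smul c (hu i), c • g, ?_, memLp_smul c hg'⟩
    convert hg.smul c using 1
    ext1 i
    fin_cases i
    · rfl
    · exact (smul_neg c (u 0)).symm

/-- `Z^{1*} = H(div; S)`. -/
def Hdiv (S : Set (ℝ × ℝ)) : Submodule ℝ (Fin 2 → Fn S) where
  carrier := {u | (∀ i, MemLp (u i) 2 (cartMeasure S)) ∧
    ∃ g, HasWeakDiv S u g ∧ MemLp g 2 (cartMeasure S)}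
  add_mem' := by
    rintro u v ⟨hu, g, hg, hg'⟩ ⟨hv, k, hk, hk'⟩
    exact ⟨fun i => memLp_add (hu i) (hv i), g + k, hg.add hk, memLp_add hg' hk'⟩
  zero_mem' := ⟨fun _ => memLp_zero, 0, HasWeakDiv.zero, memLp_zero⟩
  smul_mem' := by
    rintro c u ⟨hu, g, hg, hg'⟩
    exact ⟨fun i => memLp_smul c (hu i), c • g, hg.smul c, memLp_smul c hg'⟩

/-- `Z² = L²(S)`. -/
def L2 (S : Set (ℝ × ℝ)) : Submodule ℝ (Fn S) where
  carrier := {u | MemLp u 2 (cartMeasure S)}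
  add_mem' := memLp_add
  zero_mem' := memLp_zero
  smul_mem' := fun c _ hu => memLp_smul c hu

/-- The norm of `H(curl; S)`. -/
def hCurlNorm (S : Set (ℝ × ℝ)) (u : Fin 2 → Fn S) : ℝ :=
  Real.sqrt (l2NormVec (cartMeasure S) u ^ 2 + l2Norm (cartMeasure S) (weakCurl S u) ^ 2)

/-- The norm of `H(div; S)`. -/
def hDivNorm (S : Set (ℝ × ℝ)) (u : Fin 2 → Fn S) : ℝ :=
  Real.sqrt (l2NormVec (cartMeasure S) u ^ 2 + l2Norm (cartMeasure S) (weakDiv S u) ^ 2)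

/-- `u ∈ H^s(curl; S)`, for `u ∈ H(curl; S)`. -/
def MemHsCurl (S : Set (ℝ × ℝ)) (s : ℕ) (u : Fin 2 → Fn S) : Prop :=
  (∀ i, MemSob S (cartMeasure S) s (u i)) ∧ MemSob S (cartMeasure S) s (weakCurl S u)

/-- The norm of `H^s(curl; S)`. -/
def hsCurlNorm (S : Set (ℝ × ℝ)) (s : ℕ) (u : Fin 2 → Fn S) : ℝ :=
  Real.sqrt (sobNormVec S (cartMeasure S) s u ^ 2 +
    sobNorm S (cartMeasure S) s (weakCurl S u) ^ 2)

/-- `u ∈ H^s(div; S)`, for `u ∈ H(div; S)`. -/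
def MemHsDiv (S : Set (ℝ × ℝ)) (s : ℕ) (u : Fin 2 → Fn S) : Prop :=
  (∀ i, MemSob S (cartMeasure S) s (u i)) ∧ MemSob S (cartMeasure S) s (weakDiv S u)

/-- The norm of `H^s(div; S)`. -/
def hsDivNorm (S : Set (ℝ × ℝ)) (s : ℕ) (u : Fin 2 → Fn S) : ℝ :=
  Real.sqrt (sobNormVec S (cartMeasure S) s u ^ 2 +
    sobNorm S (cartMeasure S) s (weakDiv S u) ^ 2)

/-- A conforming discretization of the two planar Cartesian de Rham complexes
`H¹ → H(curl) → L²` and `H¹ → H(div) → L²`: finite-dimensional subspaces with `L²`-stable linear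
projectors that commute with the differential operators. -/
structure CartesianDiscretization (S : Set (ℝ × ℝ)) where
  V0 : Submodule ℝ (H1 S)
  V1 : Submodule ℝ (Hcurl S)
  V1s : Submodule ℝ (Hdiv S)
  V2 : Submodule ℝ (L2 S)
  finite0 : FiniteDimensional ℝ V0
  finite1 : FiniteDimensional ℝ V1
  finite1s : FiniteDimensional ℝ V1s
  finite2 : FiniteDimensional ℝ V2
  P0 : H1 S →ₗ[ℝ] H1 S
  P1 : Hcurl S →ₗ[ℝ] Hcurl S
  P1s : Hdiv S →ₗ[ℝ] Hdiv S
  P2 : L2 S →ₗ[ℝ] L2 S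
  proj0 : LinearMap.IsProj V0 P0
  proj1 : LinearMap.IsProj V1 P1
  proj1s : LinearMap.IsProj V1s P1s
  proj2 : LinearMap.IsProj V2 P2
  stable0 : ∃ K : ℝ, ∀ u, l2Norm (cartMeasure S) (P0 u : Fn S) ≤
    K * l2Norm (cartMeasure S) (u : Fn S)
  stable1 : ∃ K : ℝ, ∀ u, l2NormVec (cartMeasure S) (P1 u : Fin 2 → Fn S) ≤
    K * l2NormVec (cartMeasure S) (u : Fin 2 → Fn S)
  stable1s : ∃ K : ℝ, ∀ u, l2NormVec (cartMeasure S) (P1s u : Fin 2 → Fn S) ≤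
    K * l2NormVec (cartMeasure S) (u : Fin 2 → Fn S)
  stable2 : ∃ K : ℝ, ∀ u, l2Norm (cartMeasure S) (P2 u : Fn S) ≤
    K * l2Norm (cartMeasure S) (u : Fn S)
  comm_grad : ∀ (u : H1 S) (v : Hcurl S), (v : Fin 2 → Fn S) = weakGrad S u →
    (P1 v : Fin 2 → Fn S) = weakGrad S (P0 u)
  comm_curl : ∀ (u : Hcurl S) (v : L2 S), (v : Fn S) = weakCurl S u →
    (P2 v : Fn S) = weakCurl S (P1 u)
  comm_rot : ∀ (u : H1 S) (v : Hdiv S), (v : Fin 2 → Fn S) = weakRot S u →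
    (P1s v : Fin 2 → Fn S) = weakRot S (P0 u)
  comm_div : ∀ (u : Hdiv S) (v : L2 S), (v : Fn S) = weakDiv S u →
    (P2 v : Fn S) = weakDiv S (P1s u)

/-- The Cartesian interpolation estimates of order `s`, with mesh size `h` and constant `C`. -/
structure CartesianDiscretization.Estimates {S : Set (ℝ × ℝ)} (D : CartesianDiscretization S)
    (s : ℕ) (h C : ℝ) : Prop where
  est0 : ∀ u : H1 S, MemSob S (cartMeasure S) (s + 1) u →
    sobNorm S (cartMeasure S) 1 ((u - D.P0 u : H1 S) : Fn S) ≤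
      C * h ^ s * sobNorm S (cartMeasure S) (s + 1) u
  est1 : ∀ u : Hcurl S, MemHsCurl S s u →
    hCurlNorm S ((u - D.P1 u : Hcurl S) : Fin 2 → Fn S) ≤ C * h ^ s * hsCurlNorm S s u
  est1s : ∀ u : Hdiv S, MemHsDiv S s u →
    hDivNorm S ((u - D.P1s u : Hdiv S) : Fin 2 → Fn S) ≤ C * h ^ s * hsDivNorm S s u
  est2 : ∀ u : L2 S, MemSob S (cartMeasure S) s u →
    l2Norm (cartMeasure S) ((u - D.P2 u : L2 S) : Fn S) ≤
      C * h ^ s * sobNorm S (cartMeasure S) s u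

/-! ### Cylindrical operators and spaces

Vector fields are triples of components in the order `(ρ, z, θ)`. -/

/-- The function `ρ`. -/
def rho (S : Set (ℝ × ℝ)) : Fn S := AEEqFun.mk (fun p => p.1) measurable_fst.aestronglyMeasurable

/-- The function `1/ρ`. -/
def rhoInv (S : Set (ℝ × ℝ)) : Fn S :=
  AEEqFun.mk (fun p => p.1⁻¹) measurable_fst.inv.aestronglyMeasurable

/-- `grad^m u = (∂_ρ u, ∂_z u, -(m/ρ) u)`. -/
def gradM (S : Set (ℝ × ℝ)) (m : ℤ) (u : Fn S) : Fin 3 → Fn S :=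
  ![weakDeriv S 1 0 u, weakDeriv S 0 1 u, -((m : ℝ) • (rhoInv S * u))]

/-- `curl^m u = (-(m/ρ) u_z - ∂_z u_θ, (1/ρ)(∂_ρ(ρ u_θ) + m u_ρ), ∂_z u_ρ - ∂_ρ u_z)`. -/
def curlM (S : Set (ℝ × ℝ)) (m : ℤ) (u : Fin 3 → Fn S) : Fin 3 → Fn S :=
  ![-((m : ℝ) • (rhoInv S * u 1)) - weakDeriv S 0 1 (u 2),
    rhoInv S * (weakDeriv S 1 0 (rho S * u 2) + (m : ℝ) • u 0),
    weakDiv S ![- u 1, u 0]]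

/-- `div^m u = (1/ρ) ∂_ρ(ρ u_ρ) - (m/ρ) u_θ + ∂_z u_z`, where the two derivatives are taken
together as `(1/ρ) (∂_ρ(ρ u_ρ) + ∂_z(ρ u_z))`. -/
def divM (S : Set (ℝ × ℝ)) (m : ℤ) (u : Fin 3 → Fn S) : Fn S :=
  rhoInv S * weakDiv S ![rho S * u 0, rho S * u 1] - (m : ℝ) • (rhoInv S * u 2)

/-- `L_ρ²(S)`. -/
def L2rho (S : Set (ℝ × ℝ)) : Set (Fn S) := {u | MemLp u 2 (rhoMeasure S)}

/-- `H_ρ(grad^m; S)`. -/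
def HgradM (S : Set (ℝ × ℝ)) (m : ℤ) : Set (Fn S) :=
  {u | u ∈ L2rho S ∧ (∃ g, HasWeakDeriv S 1 0 u g) ∧ (∃ g, HasWeakDeriv S 0 1 u g) ∧
    ∀ i, gradM S m u i ∈ L2rho S}

/-- `H_ρ(curl^m; S)`. -/
def HcurlM (S : Set (ℝ × ℝ)) (m : ℤ) : Set (Fin 3 → Fn S) :=
  {u | (∀ i, u i ∈ L2rho S) ∧ (∃ g, HasWeakDeriv S 0 1 (u 2) g) ∧
    (∃ g, HasWeakDeriv S 1 0 (rho S * u 2) g) ∧ (∃ g, HasWeakDiv S ![- u 1, u 0] g) ∧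
    ∀ i, curlM S m u i ∈ L2rho S}

/-- `H_ρ(div^m; S)`. -/
def HdivM (S : Set (ℝ × ℝ)) (m : ℤ) : Set (Fin 3 → Fn S) :=
  {u | (∀ i, u i ∈ L2rho S) ∧ (∃ g, HasWeakDiv S ![rho S * u 0, rho S * u 1] g) ∧
    divM S m u ∈ L2rho S}

/-- The norm of `H_ρ(grad^m; S)`. -/
def hGradMNorm (S : Set (ℝ × ℝ)) (m : ℤ) (u : Fn S) : ℝ :=
  Real.sqrt (l2Norm (rhoMeasure S) u ^ 2 + l2NormVec (rhoMeasure S) (gradM S m u) ^ 2)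

/-- The norm of `H_ρ(curl^m; S)`. -/
def hCurlMNorm (S : Set (ℝ × ℝ)) (m : ℤ) (u : Fin 3 → Fn S) : ℝ :=
  Real.sqrt (l2NormVec (rhoMeasure S) u ^ 2 + l2NormVec (rhoMeasure S) (curlM S m u) ^ 2)

/-- The norm of `H_ρ(div^m; S)`. -/
def hDivMNorm (S : Set (ℝ × ℝ)) (m : ℤ) (u : Fin 3 → Fn S) : ℝ :=
  Real.sqrt (l2NormVec (rhoMeasure S) u ^ 2 + l2Norm (rhoMeasure S) (divM S m u) ^ 2)

/-! ### The maps between cylindrical and Cartesian spaces -/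

/-- `η_{m,0} u = (m/ρ) u`. -/
def eta0 (S : Set (ℝ × ℝ)) (m : ℤ) (u : Fn S) : Fn S := (m : ℝ) • (rhoInv S * u)

/-- `η_{m,1} u = ((1/ρ)(m u_ρ + u_θ), (m/ρ) u_z, u_θ)`. -/
def eta1 (S : Set (ℝ × ℝ)) (m : ℤ) (u : Fin 3 → Fn S) : Fin 3 → Fn S :=
  ![rhoInv S * ((m : ℝ) • u 0 + u 2), (m : ℝ) • (rhoInv S * u 1), u 2]

/-- `η_{m,2} u = (u_ρ, u_z, (1/ρ)(m u_θ - u_ρ))`. -/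
def eta2 (S : Set (ℝ × ℝ)) (m : ℤ) (u : Fin 3 → Fn S) : Fin 3 → Fn S :=
  ![u 0, u 1, rhoInv S * ((m : ℝ) • u 2 - u 0)]

/-- `η_{m,3} u = u`. -/
def eta3 (S : Set (ℝ × ℝ)) (u : Fn S) : Fn S := u

/-- The inverse of `η_{m,0}`. -/
def etaInv0 (S : Set (ℝ × ℝ)) (m : ℤ) (u : Fn S) : Fn S := (m : ℝ)⁻¹ • (rho S * u)

/-- The inverse of `η_{m,1}`. -/
def etaInv1 (S : Set (ℝ × ℝ)) (m : ℤ) (u : Fin 3 → Fn S) : Fin 3 → Fn S :=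
  ![(m : ℝ)⁻¹ • (rho S * u 0 - u 2), (m : ℝ)⁻¹ • (rho S * u 1), u 2]

/-- The inverse of `η_{m,2}`. -/
def etaInv2 (S : Set (ℝ × ℝ)) (m : ℤ) (u : Fin 3 → Fn S) : Fin 3 → Fn S :=
  ![u 0, u 1, (m : ℝ)⁻¹ • (rho S * u 2 + u 0)]

/-- The inverse of `η_{m,3}`. -/
def etaInv3 (S : Set (ℝ × ℝ)) (u : Fn S) : Fn S := u

theorem rho_mul_rhoInv {S : Set (ℝ × ℝ)} (hS : MeasurableSet S) (hpos : ∀ p ∈ S, 0 < p.1) :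
    rho S * rhoInv S = 1 := by
  refine AEEqFun.ext ?_
  filter_upwards [AEEqFun.coeFn_mul (rho S) (rhoInv S), AEEqFun.coeFn_one (β := ℝ),
    AEEqFun.coeFn_mk (μ := volume.restrict S) (fun p : ℝ × ℝ => p.1)
      measurable_fst.aestronglyMeasurable,
    AEEqFun.coeFn_mk (μ := volume.restrict S) (fun p : ℝ × ℝ => p.1⁻¹)
      measurable_fst.inv.aestronglyMeasurable, ae_restrict_mem hS] with p h1 h2 h3 h4 h5
  rw [h1, h2, Pi.mul_apply, rho, rhoInv, h3, h4]
  exact mul_inv_cancel₀ (hpos p h5).ne'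

theorem rho_mul_rhoInv_mul {S : Set (ℝ × ℝ)} (hS : MeasurableSet S) (hpos : ∀ p ∈ S, 0 < p.1)
    (u : Fn S) : rho S * (rhoInv S * u) = u := by
  rw [← mul_assoc, rho_mul_rhoInv hS hpos, one_mul]

theorem rhoInv_mul_rho_mul {S : Set (ℝ × ℝ)} (hS : MeasurableSet S) (hpos : ∀ p ∈ S, 0 < p.1)
    (u : Fn S) : rhoInv S * (rho S * u) = u := by
  rw [← mul_assoc, mul_comm (rhoInv S), rho_mul_rhoInv hS hpos, one_mul]

theorem mul_smul_fn {S : Set (ℝ × ℝ)} (c : ℝ) (u v : Fn S) : u * (c • v) = c • (u * v) := by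
  refine AEEqFun.ext ?_
  filter_upwards [AEEqFun.coeFn_mul u (c • v), AEEqFun.coeFn_smul c v,
    AEEqFun.coeFn_smul c (u * v), AEEqFun.coeFn_mul u v] with p h1 h2 h3 h4
  rw [h1, h3, Pi.mul_apply, Pi.smul_apply, h2, h4, Pi.smul_apply, Pi.mul_apply, smul_eq_mul,
    smul_eq_mul]
  ring

theorem etaInv0_leftInverse {S : Set (ℝ × ℝ)} (hS : MeasurableSet S) (hpos : ∀ p ∈ S, 0 < p.1)
    {m : ℤ} (hm : m ≠ 0) : Function.LeftInverse (etaInv0 S m) (eta0 S m) := fun u => by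
  have hm' : (m : ℝ) ≠ 0 := Int.cast_ne_zero.2 hm
  rw [etaInv0, eta0, mul_smul_fn, rho_mul_rhoInv_mul hS hpos, inv_smul_smul₀ hm']

theorem etaInv0_rightInverse {S : Set (ℝ × ℝ)} (hS : MeasurableSet S) (hpos : ∀ p ∈ S, 0 < p.1)
    {m : ℤ} (hm : m ≠ 0) : Function.RightInverse (etaInv0 S m) (eta0 S m) := fun u => by
  have hm' : (m : ℝ) ≠ 0 := Int.cast_ne_zero.2 hm
  rw [etaInv0, eta0, mul_smul_fn, rhoInv_mul_rho_mul hS hpos, smul_inv_smul₀ hm']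

theorem etaInv1_leftInverse {S : Set (ℝ × ℝ)} (hS : MeasurableSet S) (hpos : ∀ p ∈ S, 0 < p.1)
    {m : ℤ} (hm : m ≠ 0) : Function.LeftInverse (etaInv1 S m) (eta1 S m) := fun u => by
  have hm' : (m : ℝ) ≠ 0 := Int.cast_ne_zero.2 hm
  ext1 i
  fin_cases i
  · simp [etaInv1, eta1, mul_smul_fn, rho_mul_rhoInv_mul hS hpos, inv_smul_smul₀ hm']
  · simp [etaInv1, eta1, mul_smul_fn, rho_mul_rhoInv_mul hS hpos, inv_smul_smul₀ hm']
  · rfl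

theorem etaInv1_rightInverse {S : Set (ℝ × ℝ)} (hS : MeasurableSet S) (hpos : ∀ p ∈ S, 0 < p.1)
    {m : ℤ} (hm : m ≠ 0) : Function.RightInverse (etaInv1 S m) (eta1 S m) := fun u => by
  have hm' : (m : ℝ) ≠ 0 := Int.cast_ne_zero.2 hm
  ext1 i
  fin_cases i
  · simp [etaInv1, eta1, mul_smul_fn, rhoInv_mul_rho_mul hS hpos, smul_inv_smul₀ hm']
  · simp [etaInv1, eta1, mul_smul_fn, rhoInv_mul_rho_mul hS hpos, smul_inv_smul₀ hm']
  · rfl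

theorem etaInv2_leftInverse {S : Set (ℝ × ℝ)} (hS : MeasurableSet S) (hpos : ∀ p ∈ S, 0 < p.1)
    {m : ℤ} (hm : m ≠ 0) : Function.LeftInverse (etaInv2 S m) (eta2 S m) := fun u => by
  have hm' : (m : ℝ) ≠ 0 := Int.cast_ne_zero.2 hm
  ext1 i
  fin_cases i
  · rfl
  · rfl
  · simp [etaInv2, eta2, rho_mul_rhoInv_mul hS hpos, inv_smul_smul₀ hm']

theorem etaInv2_rightInverse {S : Set (ℝ × ℝ)} (hS : MeasurableSet S) (hpos : ∀ p ∈ S, 0 < p.1)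
    {m : ℤ} (hm : m ≠ 0) : Function.RightInverse (etaInv2 S m) (eta2 S m) := fun u => by
  have hm' : (m : ℝ) ≠ 0 := Int.cast_ne_zero.2 hm
  ext1 i
  fin_cases i
  · rfl
  · rfl
  · simp [etaInv2, eta2, rhoInv_mul_rho_mul hS hpos, smul_inv_smul₀ hm']

/-- The meridian part `(u_ρ, u_z)` of `u = (u_ρ, u_z, u_θ)`. -/
def mer {S : Set (ℝ × ℝ)} (u : Fin 3 → Fn S) : Fin 2 → Fn S := ![u 0, u 1]

/-- The regular subspace `{u ∈ H_ρ(grad^m) : η_{m,0} u ∈ H¹}`. -/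
def ZTilde0 (S : Set (ℝ × ℝ)) (m : ℤ) : Set (Fn S) :=
  {u | u ∈ HgradM S m ∧ eta0 S m u ∈ H1 S}

/-- The regular subspace `{u ∈ H_ρ(curl^m) : η_{m,1} u ∈ H(curl) × H¹}`. -/
def ZTilde1 (S : Set (ℝ × ℝ)) (m : ℤ) : Set (Fin 3 → Fn S) :=
  {u | u ∈ HcurlM S m ∧ mer (eta1 S m u) ∈ Hcurl S ∧ eta1 S m u 2 ∈ H1 S}

/-- The regular subspace `{u ∈ H_ρ(div^m) : η_{m,2} u ∈ H(div) × L²}`. -/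
def ZTilde2 (S : Set (ℝ × ℝ)) (m : ℤ) : Set (Fin 3 → Fn S) :=
  {u | u ∈ HdivM S m ∧ mer (eta2 S m u) ∈ Hdiv S ∧ eta2 S m u 2 ∈ L2 S}

/-- The regular subspace `{u ∈ L_ρ² : η_{m,3} u ∈ L²}`. -/
def ZTilde3 (S : Set (ℝ × ℝ)) : Set (Fn S) := {u | u ∈ L2rho S ∧ eta3 S u ∈ L2 S}

/-- The field with meridian part `v` and azimuthal component `w`. -/
def joinField {S : Set (ℝ × ℝ)} (v : Fin 2 → Fn S) (w : Fn S) : Fin 3 → Fn S := ![v 0, v 1, w]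

/-- `η_{m,0}⁻¹ ∘ Π⁰ ∘ η_{m,0}`. -/
def cylProj0 {S : Set (ℝ × ℝ)} (D : CartesianDiscretization S) (m : ℤ) (u : ZTilde0 S m) : Fn S :=
  etaInv0 S m (D.P0 ⟨eta0 S m u, u.2.2⟩)

/-- `η_{m,1}⁻¹ ∘ (Π¹ × Π⁰) ∘ η_{m,1}`. -/
def cylProj1 {S : Set (ℝ × ℝ)} (D : CartesianDiscretization S) (m : ℤ) (u : ZTilde1 S m) :
    Fin 3 → Fn S :=
  etaInv1 S m (joinField (D.P1 ⟨mer (eta1 S m u), u.2.2.1⟩) (D.P0 ⟨eta1 S m u 2, u.2.2.2⟩))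

/-- `η_{m,2}⁻¹ ∘ (Π^{1*} × Π²) ∘ η_{m,2}`. -/
def cylProj2 {S : Set (ℝ × ℝ)} (D : CartesianDiscretization S) (m : ℤ) (u : ZTilde2 S m) :
    Fin 3 → Fn S :=
  etaInv2 S m (joinField (D.P1s ⟨mer (eta2 S m u), u.2.2.1⟩) (D.P2 ⟨eta2 S m u 2, u.2.2.2⟩))

/-- `η_{m,3}⁻¹ ∘ Π² ∘ η_{m,3}`. -/
def cylProj3 {S : Set (ℝ × ℝ)} (D : CartesianDiscretization S) (u : ZTilde3 S) : Fn S :=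
  etaInv3 S (D.P2 ⟨eta3 S u, u.2.2⟩)

/-- `H_ρ^s(grad~^m)`: those `u ∈ H_ρ(grad^m)` with `η_{m,0} u` and `η_{m,1}(grad^m u)` in
`H_ρ^s`. -/
def RegGrad (S : Set (ℝ × ℝ)) (m : ℤ) (s : ℕ) : Set (Fn S) :=
  {u | u ∈ HgradM S m ∧ MemSob S (rhoMeasure S) s (eta0 S m u) ∧
    ∀ i, MemSob S (rhoMeasure S) s (eta1 S m (gradM S m u) i)}

/-- `H_ρ^s(curl~^m)`: those `u ∈ H_ρ(curl^m)` with `η_{m,1} u` and `η_{m,2}(curl^m u)` in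
`H_ρ^s`. -/
def RegCurl (S : Set (ℝ × ℝ)) (m : ℤ) (s : ℕ) : Set (Fin 3 → Fn S) :=
  {u | u ∈ HcurlM S m ∧ (∀ i, MemSob S (rhoMeasure S) s (eta1 S m u i)) ∧
    ∀ i, MemSob S (rhoMeasure S) s (eta2 S m (curlM S m u) i)}

/-- `H_ρ^s(div~^m)`: those `u ∈ H_ρ(div^m)` with `η_{m,2} u` and `η_{m,3}(div^m u)` in
`H_ρ^s`. -/
def RegDiv (S : Set (ℝ × ℝ)) (m : ℤ) (s : ℕ) : Set (Fin 3 → Fn S) :=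
  {u | u ∈ HdivM S m ∧ (∀ i, MemSob S (rhoMeasure S) s (eta2 S m u i)) ∧
    MemSob S (rhoMeasure S) s (eta3 S (divM S m u))}

end Axisym

end

open Axisym

/-! Two facts carry the estimates, one analytic and one algebraic.

The analytic fact is the embedding of H_ρ^{s+1}(S) in H^s(S) (`exists_sobBdd_cart`), which reduces
to H_ρ^1 ⊂ L². The weight degenerates only at boundary points on the axis ρ = 0. Near such a point S
is an epigraph, so points of S near it stay in S under small shifts along a direction e, and e
points away from the axis because S lies in ρ > 0. For a test function φ supported near the point,
put F(y) = ∫ u φ(· - y² e). The shifted φ lives where ρ ≥ y² e_ρ, so Cauchy-Schwarz against a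
function in L_ρ² costs a factor 1/y, while the chain rule supplies 2y. Hence F' is bounded on [0, τ]
(`abs_integral_mul_le_of_translate`). Since F(τ) is bounded as well, |F(0)| is at most a constant
times the H_ρ^1 norm of u times the L² norm of φ. Duality (`eLpNorm_le_of_abs_integral_mul_le`)
turns this into a local L² bound without any approximation of u by smooth functions, and compactness
of the closure of S makes it global (`rhoEmbeds_univ`).

The algebraic fact is that in grad^m, curl^m, div^m composed with η⁻¹ every factor 1/ρ cancels. What
remains involves only the Cartesian functions and their planar derivatives, with bounded
coefficients, so η⁻¹ is bounded from H¹, H(curl) × H¹, H(div) × L² into the cylindrical graph spaces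
(`exists_hGradMNorm_etaInv0_le`, `exists_hCurlMNorm_etaInv1_le`, `exists_hDivMNorm_etaInv2_le`).

The cylindrical error is η⁻¹ applied to the Cartesian error of ηu. The Cartesian estimates ask for
at most H^{s+1} regularity of ηu, and the embedding supplies it from H_ρ^{s+2}. -/

namespace Axisym

/-! ### Square integrability by duality against test functions -/

/-- A locally integrable function on an open set whose pairing with test functions is bounded by
`K` times their `L²` norm is square integrable with norm at most `K`. -/
theorem eLpNorm_le_of_abs_integral_mul_le {U : Set (ℝ × ℝ)} (hU : IsOpen U) {u : ℝ × ℝ → ℝ}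
    (hu : LocallyIntegrableOn u U) {K : ℝ} (hK : 0 ≤ K)
    (h : ∀ φ, IsTest U φ →
      |∫ p in U, u p * φ p| ≤ K * (eLpNorm φ 2 (volume.restrict U)).toReal) :
    eLpNorm u 2 (volume.restrict U) ≤ ENNReal.ofReal K := by
  have hint : ∀ φ, IsTest U φ → IntegrableOn (fun p => u p * φ p) U := by
    intro φ hφ
    have h1 : IntegrableOn (fun p => u p * φ p) (tsupport φ) :=
      (hu.integrableOn_compact_subset hφ.supp hφ.compact).mul_continuousOn
        hφ.smooth.continuous.continuousOn hφ.compact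
    have h2 : Integrable (fun p => u p * φ p) := by
      rw [← integrableOn_iff_integrable_of_support_subset (s := tsupport φ)]
      · exact h1
      · exact (Function.support_mul_subset_right _ _).trans (subset_tsupport _)
    exact h2.integrableOn
  have htest_add : ∀ φ ψ, IsTest U φ → IsTest U ψ → IsTest U (φ + ψ) := fun φ ψ hφ hψ =>
    ⟨hφ.smooth.add hψ.smooth, hφ.compact.add hψ.compact,
      (tsupport_add φ ψ).trans (Set.union_subset hφ.supp hψ.supp)⟩
  have htest_smul : ∀ (c : ℝ) φ, IsTest U φ → IsTest U (c • φ) := fun c φ hφ =>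
    ⟨hφ.smooth.const_smul c, hφ.compact.smul_left (f := fun _ => c),
      (tsupport_smul_subset_right (fun _ => c) φ).trans hφ.supp⟩
  -- The classes of test functions form a subspace of L², on which pairing with u is well defined
  -- and bounded by K.
  let W : Submodule ℝ (Lp ℝ 2 (volume.restrict U)) :=
    { carrier := {g | ∃ φ, IsTest U φ ∧ g =ᵐ[volume.restrict U] φ}
      add_mem' := by
        rintro f g ⟨φ, hφ, hf⟩ ⟨ψ, hψ, hg⟩
        exact ⟨φ + ψ, htest_add φ ψ hφ hψ, (Lp.coeFn_add f g).trans (hf.add hg)⟩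
      zero_mem' := by
        refine ⟨0, ⟨contDiff_const, HasCompactSupport.zero, ?_⟩, Lp.coeFn_zero _ _ _⟩
        rw [show tsupport (0 : ℝ × ℝ → ℝ) = ∅ by simp [tsupport]]
        exact Set.empty_subset _
      smul_mem' := by
        rintro c g ⟨φ, hφ, hg⟩
        exact ⟨c • φ, htest_smul c φ hφ, (Lp.coeFn_smul c g).trans (hg.const_smul c)⟩ }
  have hWint : ∀ g : W, IntegrableOn (fun p => u p * (g : Lp ℝ 2 (volume.restrict U)) p) U := by
    rintro ⟨g, φ, hφ, hg⟩
    refine (hint φ hφ).congr ?_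
    filter_upwards [hg] with p hp
    simp only [hp]
  let ℓ₀ : W →ₗ[ℝ] ℝ :=
    { toFun := fun g => ∫ p in U, u p * (g : Lp ℝ 2 (volume.restrict U)) p
      map_add' := fun f g => by
        rw [← integral_add (hWint f) (hWint g)]
        refine integral_congr_ae ?_
        filter_upwards [Lp.coeFn_add (f : Lp ℝ 2 (volume.restrict U)) g] with p hp
        rw [Submodule.coe_add, hp, Pi.add_apply, mul_add]
      map_smul' := fun c g => by
        rw [RingHom.id_apply, smul_eq_mul, ← integral_const_mul]
        refine integral_congr_ae ?_
        filter_upwards [Lp.coeFn_smul c (g : Lp ℝ 2 (volume.restrict U))] with p hp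
        rw [Submodule.coe_smul, hp, Pi.smul_apply, smul_eq_mul]
        ring }
  have hbound : ∀ g : W, ‖ℓ₀ g‖ ≤ K * ‖g‖ := by
    rintro ⟨g, φ, hφ, hg⟩
    have e1 : ℓ₀ ⟨g, φ, hφ, hg⟩ = ∫ p in U, u p * φ p := by
      refine integral_congr_ae ?_
      filter_upwards [hg] with p hp
      simp only [hp]
    have e2 : ‖(⟨g, φ, hφ, hg⟩ : W)‖ = (eLpNorm φ 2 (volume.restrict U)).toReal := by
      rw [Submodule.coe_norm, Lp.norm_def, eLpNorm_congr_ae hg]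
    rw [e1, e2]
    exact h φ hφ
  -- Hahn-Banach extends the functional without increasing its norm, so density of test functions is
  -- not needed; Riesz then represents it by some v in L².
  obtain ⟨ℓ, hℓ, hℓn⟩ := exists_extension_norm_eq W (ℓ₀.mkContinuous K hbound)
  let v := (InnerProductSpace.toDual ℝ (Lp ℝ 2 (volume.restrict U))).symm ℓ
  have hv : ‖v‖ ≤ K := by
    rw [LinearIsometryEquiv.norm_map, hℓn]
    exact LinearMap.mkContinuous_norm_le _ hK _
  have hvφ : ∀ φ, IsTest U φ → ∫ p in U, v p * φ p = ∫ p in U, u p * φ p := by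
    intro φ hφ
    have hφL : MemLp φ 2 (volume.restrict U) :=
      hφ.smooth.continuous.memLp_of_hasCompactSupport hφ.compact
    have hW : hφL.toLp φ ∈ W := ⟨φ, hφ, hφL.coeFn_toLp⟩
    have e1 : inner ℝ v (hφL.toLp φ) = ℓ₀ ⟨_, hW⟩ := by
      rw [InnerProductSpace.toDual_symm_apply]
      exact hℓ ⟨_, hW⟩
    rw [L2.inner_def] at e1
    calc ∫ p in U, v p * φ p = ∫ p in U, inner ℝ (v p) (hφL.toLp φ p) := by
          refine integral_congr_ae ?_
          filter_upwards [hφL.coeFn_toLp] with p hp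
          rw [hp, RCLike.inner_apply, conj_trivial, mul_comm]
      _ = ∫ p in U, u p * (hφL.toLp φ) p := e1
      _ = ∫ p in U, u p * φ p := by
          refine integral_congr_ae ?_
          filter_upwards [hφL.coeFn_toLp] with p hp
          rw [hp]
  have hvloc : LocallyIntegrableOn v U := by
    rw [locallyIntegrableOn_iff hU.isLocallyClosed]
    intro k hk hc
    have : IsFiniteMeasure (volume.restrict k) := ⟨by simpa using hc.measure_lt_top⟩
    exact (((Lp.memLp v).mono_measure (Measure.restrict_mono_set _ hk)).integrable
      (by norm_num))
  have hvint : ∀ φ, IsTest U φ → IntegrableOn (fun p => v p * φ p) U := fun φ hφ =>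
    (Lp.memLp v).integrable_mul (q := 2) 
      (hφ.smooth.continuous.memLp_of_hasCompactSupport hφ.compact)
  -- u and v have the same pairing with every test function, so the fundamental lemma of the
  -- calculus of variations identifies them.
  have h0 := hU.ae_eq_zero_of_integral_contDiff_smul_eq_zero (hu.sub hvloc)
    (fun φ h1 h2 h3 => by
      have ht : IsTest U φ := ⟨h1, h2, h3⟩
      have e : ∀ p, φ p • (u - v) p = u p * φ p - v p * φ p := fun p => by
        rw [smul_eq_mul, Pi.sub_apply]; ring
      simp only [e]
      rw [← setIntegral_eq_integral_of_forall_compl_eq_zero (s := U),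
        integral_sub (hint φ ht) (hvint φ ht), hvφ φ ht, sub_self]
      intro p hp
      have : φ p = 0 := image_eq_zero_of_notMem_tsupport fun hh => hp (h3 hh)
      simp [this])
  have huv : u =ᵐ[volume.restrict U] v := by
    refine (ae_restrict_iff' hU.measurableSet).2 ?_
    filter_upwards [h0] with p hp hpU
    exact sub_eq_zero.1 (hp hpU)
  rw [eLpNorm_congr_ae huv, ← ENNReal.ofReal_toReal (Lp.eLpNorm_ne_top v), ← Lp.norm_def]
  exact ENNReal.ofReal_le_ofReal hv

/-! ### Comparison of the weighted and the unweighted `L²` norms -/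

theorem rhoMeasure_absolutelyContinuous (S : Set (ℝ × ℝ)) :
    rhoMeasure S ≪ volume.restrict S := withDensity_absolutelyContinuous _ _

theorem restrict_le_smul_rhoMeasure {S A : Set (ℝ × ℝ)}
    (hA : MeasurableSet A) (hAS : A ⊆ S) {δ : ℝ} (hδ : 0 < δ) (h : ∀ p ∈ A, δ ≤ p.1) :
    volume.restrict A ≤ ENNReal.ofReal δ⁻¹ • rhoMeasure S := by
  refine Measure.le_iff.2 fun s hs => ?_
  have h1 : ENNReal.ofReal δ * volume (s ∩ A) ≤ rhoMeasure S s := by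
    rw [rhoMeasure, withDensity_apply _ hs, Measure.restrict_restrict hs,
      ← setLIntegral_const]
    refine (setLIntegral_mono' (hs.inter hA) fun p hp => ?_).trans
      (lintegral_mono_set (Set.inter_subset_inter_right s hAS))
    exact ENNReal.ofReal_le_ofReal (h p hp.2)
  rw [Measure.restrict_apply hs, Measure.smul_apply, smul_eq_mul]
  calc volume (s ∩ A) = ENNReal.ofReal δ⁻¹ * (ENNReal.ofReal δ * volume (s ∩ A)) := by
        rw [← mul_assoc, ← ENNReal.ofReal_mul (by positivity), inv_mul_cancel₀ hδ.ne',
          ENNReal.ofReal_one, one_mul]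
    _ ≤ _ := by gcongr

/-- The weight is at least δ on A, and an L² norm scales with the square root of the measure. With δ
= y² e_ρ this loses exactly one power of y. -/
theorem eLpNorm_restrict_le_rho {S A : Set (ℝ × ℝ)}
    (hA : MeasurableSet A) (hAS : A ⊆ S) {δ : ℝ} (hδ : 0 < δ) (h : ∀ p ∈ A, δ ≤ p.1)
    (u : ℝ × ℝ → ℝ) :
    eLpNorm u 2 (volume.restrict A) ≤
      ENNReal.ofReal (Real.sqrt δ)⁻¹ * eLpNorm u 2 (rhoMeasure S) := by
  refine (eLpNorm_mono_measure u (restrict_le_smul_rhoMeasure hA hAS hδ h)).trans ?_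
  rw [eLpNorm_smul_measure_of_ne_top (by norm_num), smul_eq_mul,
    ENNReal.ofReal_rpow_of_nonneg (by positivity) (by positivity)]
  refine le_of_eq ?_
  congr 2
  rw [← Real.sqrt_inv, Real.sqrt_eq_rpow]
  norm_num

theorem rhoMeasure_le_smul {S : Set (ℝ × ℝ)} (hS : MeasurableSet S) {R : ℝ}
    (h : ∀ p ∈ S, p.1 ≤ R) : rhoMeasure S ≤ ENNReal.ofReal R • volume.restrict S := by
  refine Measure.le_iff.2 fun s hs => ?_
  rw [rhoMeasure, withDensity_apply _ hs, Measure.restrict_restrict hs, Measure.smul_apply,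
    smul_eq_mul, Measure.restrict_apply hs, ← setLIntegral_const]
  exact setLIntegral_mono' (hs.inter hS) fun p hp => ENNReal.ofReal_le_ofReal (h p hp.2)

theorem eLpNorm_rho_le {S : Set (ℝ × ℝ)} (hS : MeasurableSet S) {R : ℝ} (hR : 0 ≤ R)
    (h : ∀ p ∈ S, p.1 ≤ R) (u : ℝ × ℝ → ℝ) :
    eLpNorm u 2 (rhoMeasure S) ≤
      ENNReal.ofReal (Real.sqrt R) * eLpNorm u 2 (volume.restrict S) := by
  refine (eLpNorm_mono_measure u (rhoMeasure_le_smul hS h)).trans ?_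
  rw [eLpNorm_smul_measure_of_ne_top (by norm_num), smul_eq_mul,
    ENNReal.ofReal_rpow_of_nonneg hR (by positivity)]
  refine le_of_eq ?_
  congr 2
  rw [Real.sqrt_eq_rpow]
  norm_num

theorem eLpNorm_restrict_union_le (u : ℝ × ℝ → ℝ) (A B : Set (ℝ × ℝ)) :
    eLpNorm u 2 (volume.restrict (A ∪ B)) ≤
      eLpNorm u 2 (volume.restrict A) + eLpNorm u 2 (volume.restrict B) := by
  simp only [eLpNorm_eq_lintegral_rpow_enorm_toReal (p := 2) (by norm_num) (by norm_num)]
  refine (ENNReal.rpow_le_rpow (lintegral_union_le _ A B) (by positivity)).trans ?_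
  exact ENNReal.rpow_add_le_add_rpow _ _ (by positivity) (by norm_num)

/-- Cauchy-Schwarz for a function in `L_ρ²` and a test function that lives where `ρ ≥ δ`. -/
theorem abs_integral_mul_le_rho {S : Set (ℝ × ℝ)} (hS : MeasurableSet S) {g : Fn S}
    {M : ℝ} (hg : eLpNorm g 2 (rhoMeasure S) ≤ ENNReal.ofReal M) (hM : 0 ≤ M)
    {ψ : ℝ × ℝ → ℝ} (hψ : IsTest S ψ) {δ : ℝ} (hδ : 0 < δ) (h : ∀ p ∈ tsupport ψ, δ ≤ p.1) :
    |∫ p in S, g p * ψ p| ≤ (Real.sqrt δ)⁻¹ * M * (eLpNorm ψ 2 volume).toReal := by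
  have hA : MeasurableSet (tsupport ψ) := (isClosed_tsupport ψ).measurableSet
  have hψL : MemLp ψ 2 volume := hψ.smooth.continuous.memLp_of_hasCompactSupport hψ.compact
  -- Only on the support of ψ is the weight bounded below, so the unweighted norm of g is taken
  -- there.
  have e : ∫ p in S, g p * ψ p = ∫ p in tsupport ψ, g p * ψ p := by
    rw [← setIntegral_eq_of_subset_of_forall_sdiff_eq_zero hS hψ.supp]
    intro p hp
    rw [image_eq_zero_of_notMem_tsupport hp.2, mul_zero]
  have hgm : AEStronglyMeasurable g (volume.restrict (tsupport ψ)) :=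
    g.aestronglyMeasurable.mono_measure (Measure.restrict_mono_set _ hψ.supp)
  have hle := eLpNorm_smul_le_mul_eLpNorm (p := 2) (q := 2) (r := 1)
    (hψL.1.mono_measure (Measure.restrict_le_self (s := tsupport ψ))) hgm
  rw [e, ← Real.norm_eq_abs]
  refine (norm_integral_le_lintegral_norm _).trans ?_
  have e2 : ∫⁻ p in tsupport ψ, ENNReal.ofReal ‖g p * ψ p‖ =
      eLpNorm (⇑g • ψ) 1 (volume.restrict (tsupport ψ)) := by
    rw [eLpNorm_one_eq_lintegral_enorm]
    simp only [ofReal_norm, Pi.smul_apply', smul_eq_mul]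
  rw [e2]
  refine ENNReal.toReal_le_of_le_ofReal (by positivity) (hle.trans ?_)
  rw [ENNReal.ofReal_mul (by positivity), ENNReal.ofReal_mul (by positivity),
    ENNReal.ofReal_toReal hψL.eLpNorm_ne_top]
  gcongr
  · exact (eLpNorm_restrict_le_rho hA hψ.supp hδ h g).trans (by gcongr)
  · exact Measure.restrict_le_self

/-! ### The embedding of `H_ρ¹(S)` into `L²(S)` -/

theorem tsupport_comp_sub (φ : ℝ × ℝ → ℝ) (a : ℝ × ℝ) :
    tsupport (fun q => φ (q - a)) = (fun q => q - a) ⁻¹' tsupport φ :=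
  tsupport_comp_eq_preimage φ (Homeomorph.subRight a)

theorem IsTest.comp_sub {U S : Set (ℝ × ℝ)} {φ : ℝ × ℝ → ℝ} (hφ : IsTest U φ) {a : ℝ × ℝ}
    (h : ∀ p ∈ U, p + a ∈ S) : IsTest S (fun q => φ (q - a)) := by
  refine ⟨hφ.smooth.comp (contDiff_id.sub contDiff_const),
    hφ.compact.comp_homeomorph (Homeomorph.subRight a), fun q hq => ?_⟩
  rw [tsupport_comp_sub] at hq
  simpa using h _ (hφ.supp hq)

/-- Shifting by `y ^ 2 • e` instead of `y • e` makes the chain rule produce a factor 2y, which later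
absorbs the singularity of the weighted bound at y = 0. All derivatives fall on φ, so u need only be
integrable. -/
theorem hasDerivAt_integral_mul_comp_sub {μ : Measure (ℝ × ℝ)} {u φ : ℝ × ℝ → ℝ}
    (hu : Integrable u μ) (hφ : ContDiff ℝ 1 φ) (hc : HasCompactSupport φ)
    (e : ℝ × ℝ) (x : ℝ) :
    HasDerivAt (fun y : ℝ => ∫ q, u q * φ (q - y ^ 2 • e) ∂μ)
      (∫ q, u q * (fderiv ℝ φ (q - x ^ 2 • e) (-(2 * x) • e)) ∂μ) x := by
  obtain ⟨B, hB⟩ := hc.exists_bound_of_continuous hφ.continuous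
  have hcont := hφ.continuous_fderiv one_ne_zero
  obtain ⟨B', hB'⟩ := (hc.fderiv ℝ).exists_bound_of_continuous hcont
  have hB'0 : 0 ≤ B' := (norm_nonneg _).trans (hB' 0)
  have hmeas : ∀ y : ℝ, AEStronglyMeasurable (fun q => u q * φ (q - y ^ 2 • e)) μ := fun y =>
    hu.1.mul (hφ.continuous.comp (continuous_id.sub continuous_const)).aestronglyMeasurable
  refine (hasDerivAt_integral_of_dominated_loc_of_deriv_le
    (F' := fun y q => u q * (fderiv ℝ φ (q - y ^ 2 • e) (-(2 * y) • e)))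
    -- On the unit ball about x one has |y| ≤ |x| + 1, which bounds the factor 2y.
    (bound := fun q => ‖u q‖ * (B' * (2 * (|x| + 1) * ‖e‖)))
    (Metric.ball_mem_nhds x one_pos) (Filter.Eventually.of_forall hmeas) ?_ ?_ ?_ ?_ ?_).2
  · exact hu.mul_bdd (c := B)
      (hφ.continuous.comp (continuous_id.sub continuous_const)).aestronglyMeasurable
      (Filter.Eventually.of_forall fun q => hB _)
  · exact hu.1.mul ((hcont.comp (continuous_id.sub continuous_const)).clm_apply
      continuous_const).aestronglyMeasurable
  · refine Filter.Eventually.of_forall fun q y hy => ?_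
    rw [norm_mul]
    gcongr
    refine (ContinuousLinearMap.le_opNorm _ _).trans ?_
    gcongr
    · exact hB' _
    · rw [norm_smul, norm_neg, norm_mul, Real.norm_eq_abs, Real.norm_eq_abs, abs_two]
      gcongr
      have h1 := abs_sub_abs_le_abs_sub y x
      rw [Metric.mem_ball, Real.dist_eq] at hy
      linarith
  · exact hu.norm.mul_const _
  · refine Filter.Eventually.of_forall fun q y _ => ?_
    have h1 : HasDerivAt (fun y : ℝ => q - y ^ 2 • e) (-(2 * y) • e) y := by
      have := ((hasDerivAt_pow 2 y).smul_const e).const_sub q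
      simpa using this
    exact (((hφ.differentiable one_ne_zero) _).hasFDerivAt.comp_hasDerivAt y h1).const_mul _

/-- If `U` can be moved inside `S` along a direction `e` in which `ρ` increases, then the pairing
of `u` with test functions of `U` is controlled by the norm of `u` in `H_ρ¹(S)`. -/
theorem abs_integral_mul_le_of_translate {S U : Set (ℝ × ℝ)} (hS : MeasurableSet S)
    (hpos : ∀ p ∈ S, 0 < p.1) (hUS : U ⊆ S) {e : ℝ × ℝ} (he : 0 < e.1) (he1 : |e.1| ≤ 1)
    (he2 : |e.2| ≤ 1) {τ : ℝ} (hτ : 0 < τ)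
    (htr : ∀ y ∈ Set.Icc 0 τ, ∀ p ∈ U, p + y ^ 2 • e ∈ S) {u g₁ g₂ : Fn S} {M : ℝ}
    (h1 : HasWeakDeriv S 1 0 u g₁) (h2 : HasWeakDeriv S 0 1 u g₂) (hM : 0 ≤ M)
    (hu : eLpNorm u 2 (rhoMeasure S) ≤ ENNReal.ofReal M)
    (hg₁ : eLpNorm g₁ 2 (rhoMeasure S) ≤ ENNReal.ofReal M)
    (hg₂ : eLpNorm g₂ 2 (rhoMeasure S) ≤ ENNReal.ofReal M)
    {φ : ℝ × ℝ → ℝ} (hφ : IsTest U φ) :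
    |∫ p in S, u p * φ p| ≤
      ((Real.sqrt (τ ^ 2 * e.1))⁻¹ + 4 * (Real.sqrt e.1)⁻¹ * τ) * M *
        (eLpNorm φ 2 volume).toReal := by
  set N := (eLpNorm φ 2 volume).toReal with hN
  have hN0 : 0 ≤ N := ENNReal.toReal_nonneg
  have htest : ∀ y ∈ Set.Icc 0 τ, IsTest S (fun q => φ (q - y ^ 2 • e)) := fun y hy =>
    hφ.comp_sub (htr y hy)
  have hnorm : ∀ a, (eLpNorm (fun q => φ (q - a)) 2 volume).toReal = N := fun a => by
    rw [hN, ← eLpNorm_comp_measurePreserving hφ.smooth.continuous.aestronglyMeasurable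
      (measurePreserving_sub_right volume a)]
    rfl
  have hsupp : ∀ y : ℝ, ∀ q ∈ tsupport (fun q => φ (q - y ^ 2 • e)), y ^ 2 * e.1 ≤ q.1 := by
    intro y q hq
    rw [tsupport_comp_sub] at hq
    have := hpos _ (hUS (hφ.supp hq))
    simp only [Prod.fst_sub, Prod.smul_fst, smul_eq_mul] at this
    linarith
  -- u is only locally integrable on S. The supports of all the shifted test functions sweep out one
  -- compact subset of S, on which differentiation under the integral is legitimate.
  set K : Set (ℝ × ℝ) := (fun z : ℝ × ℝ × ℝ => z.2 + z.1 ^ 2 • e) '' (Set.Icc 0 τ ×ˢ tsupport φ)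
    with hK
  have hKc : IsCompact K := (isCompact_Icc.prod hφ.compact).image (by fun_prop)
  have hKS : K ⊆ S := by
    rintro _ ⟨⟨y, p⟩, ⟨hy, hp⟩, rfl⟩
    exact htr y hy p (hφ.supp hp)
  have hmemK : ∀ y ∈ Set.Icc 0 τ, ∀ q, q ∉ K → q - y ^ 2 • e ∉ tsupport φ := by
    intro y hy q hq hq'
    exact hq ⟨(y, q - y ^ 2 • e), ⟨hy, hq'⟩, by simp⟩
  have hSK : ∀ y ∈ Set.Icc 0 τ,
      ∫ q in S, u q * φ (q - y ^ 2 • e) = ∫ q in K, u q * φ (q - y ^ 2 • e) := fun y hy => by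
    rw [← setIntegral_eq_of_subset_of_forall_sdiff_eq_zero hS hKS]
    intro q hq
    rw [image_eq_zero_of_notMem_tsupport (hmemK y hy q hq.2), mul_zero]
  have hderiv : ∀ y, _ := fun y => hasDerivAt_integral_mul_comp_sub (h1.1 K hKS hKc)
    (hφ.smooth.of_le (by exact_mod_cast le_top)) hφ.compact e y
  -- Each of the two partial derivatives contributes 2y · 1/(y √e_ρ) = 2/√e_ρ, hence the 4; the
  -- bound does not depend on y.
  have hbound : ∀ y ∈ Set.Icc 0 τ,
      ‖∫ q in K, u q * (fderiv ℝ φ (q - y ^ 2 • e) (-(2 * y) • e))‖ ≤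
        4 * (Real.sqrt e.1)⁻¹ * M * N := by
    intro y hy
    set ψ : ℝ × ℝ → ℝ := fun q => φ (q - y ^ 2 • e) with hψdef
    have hψ : IsTest S ψ := htest y hy
    have hψd : ∀ q, fderiv ℝ ψ q = fderiv ℝ φ (q - y ^ 2 • e) := fun q =>
      fderiv_comp_sub (f := φ) (y ^ 2 • e)
    have e1 : ∫ q in K, u q * (fderiv ℝ φ (q - y ^ 2 • e) (-(2 * y) • e)) =
        ∫ q in S, (-(2 * y) * e.1 * (u q * pdRho ψ q) + -(2 * y) * e.2 * (u q * pdZ ψ q)) := by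
      rw [← setIntegral_eq_of_subset_of_forall_sdiff_eq_zero hS hKS]
      · refine integral_congr_ae (Filter.Eventually.of_forall fun q => ?_)
        have he' : -(2 * y) • e = (-(2 * y) * e.1) • ((1, 0) : ℝ × ℝ) +
            (-(2 * y) * e.2) • ((0, 1) : ℝ × ℝ) := by ext <;> simp
        simp only [pdRho, pdZ, hψd]
        rw [he', map_add, map_smul, map_smul, smul_eq_mul, smul_eq_mul]
        ring
      · intro q hq
        have : fderiv ℝ φ (q - y ^ 2 • e) = 0 := image_eq_zero_of_notMem_tsupport
          fun hh => hmemK y hy q hq.2 (tsupport_fderiv_subset ℝ hh)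
        rw [this, zero_apply, mul_zero]
    have w1 : ∫ q in S, u q * pdRho ψ q = -∫ q in S, g₁ q * ψ q := by
      simpa using h1.2.2 ψ hψ
    have w2 : ∫ q in S, u q * pdZ ψ q = -∫ q in S, g₂ q * ψ q := by
      simpa using h2.2.2 ψ hψ
    have i1 : IntegrableOn (fun q => u q * pdRho ψ q) S := h1.1.integrable_mul (hψ.pd _)
    have i2 : IntegrableOn (fun q => u q * pdZ ψ q) S := h1.1.integrable_mul (hψ.pd _)
    rw [e1, integral_add (i1.const_mul _) (i2.const_mul _), integral_const_mul, integral_const_mul, w1, w2]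
    -- At y = 0 the lower bound on ρ is void, but the factor 2y makes the derivative vanish.
    rcases hy.1.eq_or_lt with h0 | h0
    · rw [← h0]
      simp only [mul_zero, neg_zero, zero_mul, add_zero, norm_zero]
      positivity
    have hδ : 0 < y ^ 2 * e.1 := by positivity
    have b1 := abs_integral_mul_le_rho hS hg₁ hM hψ hδ (hsupp y)
    have b2 := abs_integral_mul_le_rho hS hg₂ hM hψ hδ (hsupp y)
    rw [hnorm, Real.sqrt_mul (sq_nonneg y), Real.sqrt_sq h0.le] at b1 b2
    have aux : ∀ (c I : ℝ), |c| ≤ 1 → |I| ≤ (y * Real.sqrt e.1)⁻¹ * M * N →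
        |-(2 * y) * c * -I| ≤ 2 * (Real.sqrt e.1)⁻¹ * M * N := by
      intro c I hc hI
      have e3 : |-(2 * y) * c * -I| = 2 * y * (|c| * |I|) := by
        rw [abs_mul, abs_mul, abs_neg, abs_neg, abs_mul, abs_two, abs_of_pos h0]
        ring
      have e4 : 2 * y * (1 * ((y * Real.sqrt e.1)⁻¹ * M * N)) =
          2 * (Real.sqrt e.1)⁻¹ * M * N := by
        rw [mul_inv]
        field_simp
      rw [e3, ← e4]
      gcongr
    refine (norm_add_le _ _).trans ?_
    have := aux _ _ he1 b1
    have := aux _ _ he2 b2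
    simp only [Real.norm_eq_abs]
    linarith
  -- The mean value inequality on [0, τ] compares the pairing with φ to the pairing with φ shifted
  -- by τ² e, which lives where ρ ≥ τ² e_ρ.
  have hmv := norm_image_sub_le_of_norm_deriv_le_segment'
    (fun y _ => (hderiv y).hasDerivWithinAt) (fun y hy => hbound y (Set.Ico_subset_Icc_self hy))
    τ (Set.right_mem_Icc.2 hτ.le)
  rw [← hSK τ (Set.right_mem_Icc.2 hτ.le), ← hSK 0 (Set.left_mem_Icc.2 hτ.le)] at hmv
  have hend := abs_integral_mul_le_rho hS hu hM (htest τ (Set.right_mem_Icc.2 hτ.le))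
    (by positivity) (hsupp τ)
  rw [hnorm] at hend
  have e0 : ∫ q in S, u q * φ (q - (0 : ℝ) ^ 2 • e) = ∫ q in S, u q * φ q := by simp
  rw [e0, Real.norm_eq_abs] at hmv
  have htri := abs_sub_abs_le_abs_sub (∫ q in S, u q * φ q)
    (∫ q in S, u q * φ (q - τ ^ 2 • e))
  rw [abs_sub_comm] at htri
  nlinarith

/-- The square integrability on `S ∩ N`, with a bound, of the functions in `H_ρ¹(S)`. -/
def RhoEmbeds (S N : Set (ℝ × ℝ)) : Prop :=
  ∃ K : ℝ, 0 ≤ K ∧ ∀ (u g₁ g₂ : Fn S) (M : ℝ), HasWeakDeriv S 1 0 u g₁ →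
    HasWeakDeriv S 0 1 u g₂ → 0 ≤ M → eLpNorm u 2 (rhoMeasure S) ≤ ENNReal.ofReal M →
    eLpNorm g₁ 2 (rhoMeasure S) ≤ ENNReal.ofReal M →
    eLpNorm g₂ 2 (rhoMeasure S) ≤ ENNReal.ofReal M →
    eLpNorm u 2 (volume.restrict (S ∩ N)) ≤ ENNReal.ofReal (K * M)

theorem rhoEmbeds_of_translate {S N : Set (ℝ × ℝ)} (hS : IsOpen S) (hN : IsOpen N)
    (hpos : ∀ p ∈ S, 0 < p.1) {e : ℝ × ℝ} (he : 0 < e.1) (he1 : |e.1| ≤ 1)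
    (he2 : |e.2| ≤ 1) {τ : ℝ} (hτ : 0 < τ)
    (htr : ∀ y ∈ Set.Icc 0 τ, ∀ p ∈ S ∩ N, p + y ^ 2 • e ∈ S) : RhoEmbeds S N := by
  refine ⟨(Real.sqrt (τ ^ 2 * e.1))⁻¹ + 4 * (Real.sqrt e.1)⁻¹ * τ, by positivity,
    fun u g₁ g₂ M h1 h2 hM hu hg₁ hg₂ => ?_⟩
  refine eLpNorm_le_of_abs_integral_mul_le (hS.inter hN) ?_ (by positivity) fun φ hφ => ?_
  · rw [locallyIntegrableOn_iff (hS.inter hN).isLocallyClosed]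
    exact fun k hk hc => h1.1 k (hk.trans Set.inter_subset_left) hc
  · have key := abs_integral_mul_le_of_translate hS.measurableSet hpos Set.inter_subset_left
      he he1 he2 hτ htr h1 h2 hM hu hg₁ hg₂ hφ
    have e1 : ∫ p in S ∩ N, u p * φ p = ∫ p in S, u p * φ p := by
      rw [← setIntegral_eq_of_subset_of_forall_sdiff_eq_zero hS.measurableSet
        Set.inter_subset_left]
      intro q hq
      rw [image_eq_zero_of_notMem_tsupport fun hh => hq.2 (hφ.supp hh), mul_zero]
    rw [e1, eLpNorm_restrict_eq_of_support_subset ((subset_tsupport φ).trans hφ.supp)]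
    exact key

/-- Off the axis the weight is bounded below near x and nothing else is needed. On the axis x is a
boundary point, and the epigraph direction of its chart serves as the direction of translation. -/
theorem exists_rhoEmbeds_nhds {S : Set (ℝ × ℝ)} (hS : IsBoundedLipschitzDomain S)
    (hpos : ∀ p ∈ S, 0 < p.1) {x : ℝ × ℝ} (hx : x ∈ closure S) :
    ∃ N ∈ nhds x, RhoEmbeds S N := by
  rcases lt_or_ge 0 x.1 with h0 | h0
  · have hN : IsOpen {p : ℝ × ℝ | x.1 / 2 < p.1} := isOpen_lt continuous_const continuous_fst
    refine ⟨{p | x.1 / 2 < p.1}, hN.mem_nhds (half_lt_self h0), (Real.sqrt (x.1 / 2))⁻¹,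
      by positivity, fun u g₁ g₂ M _ _ _ hu _ _ => ?_⟩
    refine (eLpNorm_restrict_le_rho (hS.isOpen.inter hN).measurableSet Set.inter_subset_left
      (half_pos h0) (fun p hp => le_of_lt hp.2) u).trans ?_
    rw [ENNReal.ofReal_mul (by positivity)]
    gcongr
  · have hxS : x ∉ S := fun h => absurd (hpos x h) h0.not_gt
    obtain ⟨t, r, L, f, hr, hf, hchart⟩ := hS.lipschitz_boundary x
      (by rw [hS.isOpen.frontier_eq]; exact ⟨hx, hxS⟩)
    set e : ℝ × ℝ := (-Real.sin t, Real.cos t) with he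
    have hsq := Real.sin_sq_add_cos_sq t
    have he1 : |e.1| ≤ 1 := by simpa [he] using Real.abs_sin_le_one t
    have he2 : |e.2| ≤ 1 := Real.abs_cos_le_one t
    have hen : ‖e‖ ≤ 1 := max_le he1 he2
    have hy1 : ∀ (p : ℝ × ℝ) (a : ℝ), Real.cos t * (p + a • e).1 + Real.sin t * (p + a • e).2 =
        Real.cos t * p.1 + Real.sin t * p.2 := fun p a => by
      simp [he]; ring
    have hy2 : ∀ (p : ℝ × ℝ) (a : ℝ), -Real.sin t * (p + a • e).1 + Real.cos t * (p + a • e).2 =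
        -Real.sin t * p.1 + Real.cos t * p.2 + a := fun p a => by
      simp only [he, Prod.fst_add, Prod.snd_add, Prod.smul_fst, Prod.smul_snd, smul_eq_mul]
      linear_combination a * hsq
    -- Points strictly below the graph have a neighbourhood that misses S, so a point of the closure
    -- cannot be one of them.
    have hxf : f (Real.cos t * x.1 + Real.sin t * x.2) ≤
        -Real.sin t * x.1 + Real.cos t * x.2 := by
      by_contra! hlt
      have hcont := hf.continuous
      have hopen : IsOpen ({p : ℝ × ℝ | -Real.sin t * p.1 + Real.cos t * p.2 <
          f (Real.cos t * p.1 + Real.sin t * p.2)} ∩ Metric.ball x r) :=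
        (isOpen_lt (by fun_prop) (by fun_prop)).inter Metric.isOpen_ball
      obtain ⟨p, ⟨hp1, hp2⟩, hpS⟩ := mem_closure_iff.1 hx _ hopen ⟨hlt, Metric.mem_ball_self hr⟩
      exact lt_asymm hp1 ((hchart p hp2).1 hpS)
    have hball : ∀ (p : ℝ × ℝ) (a : ℝ), 0 ≤ a → dist (p + a • e) x ≤ dist p x + a := by
      intro p a ha
      refine (dist_triangle _ p x).trans ?_
      rw [dist_self_add_left, norm_smul, Real.norm_of_nonneg ha, add_comm]
      nlinarith
    -- Moving from x along e enters S, where ρ > 0, while ρ ≤ 0 at x; so ρ must increase along e.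
    have hepos : 0 < e.1 := by
      have h1 : x + (r / 2) • e ∈ S := by
        refine (hchart _ ?_).2 ?_
        · have := hball x (r / 2) (by positivity)
          rw [dist_self] at this
          rw [Metric.mem_ball]
          linarith
        · rw [hy1, hy2]
          linarith
      have h2 := hpos _ h1
      simp only [Prod.fst_add, Prod.smul_fst, smul_eq_mul] at h2
      by_contra! h3
      nlinarith
    -- With y² ≤ r/4 and ‖e‖ ≤ 1, points within r/2 of x stay within r of it after the shift, so the
    -- chart still applies to them.
    refine ⟨Metric.ball x (r / 2), Metric.ball_mem_nhds x (half_pos hr),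
      rhoEmbeds_of_translate hS.isOpen Metric.isOpen_ball hpos hepos he1 he2
        (τ := Real.sqrt (r / 4)) (by positivity) ?_⟩
    rintro y ⟨hy0, hyτ⟩ p ⟨hpS, hpx⟩
    have hy4 : y ^ 2 ≤ r / 4 := by
      rw [← Real.sq_sqrt (show 0 ≤ r / 4 by positivity)]
      gcongr
    rw [Metric.mem_ball] at hpx
    have hpr : p ∈ Metric.ball x r := by
      rw [Metric.mem_ball]; linarith
    refine (hchart _ ?_).2 ?_
    · rw [Metric.mem_ball]
      have := hball p (y ^ 2) (sq_nonneg y)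
      linarith
    · rw [hy1, hy2]
      have := (hchart p hpr).1 hpS
      nlinarith [sq_nonneg y]

theorem rhoEmbeds_univ {S : Set (ℝ × ℝ)} (hS : IsBoundedLipschitzDomain S)
    (hpos : ∀ p ∈ S, 0 < p.1) : RhoEmbeds S Set.univ := by
  have hc : IsCompact (closure S) := hS.isBounded.isCompact_closure
  have mono : ∀ ⦃s t : Set (ℝ × ℝ)⦄, s ⊆ t → RhoEmbeds S t → RhoEmbeds S s := by
    rintro s t hst ⟨K, hK, h⟩
    refine ⟨K, hK, fun u g₁ g₂ M h1 h2 hM hu hg₁ hg₂ =>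
      le_trans (eLpNorm_mono_measure _ (Measure.restrict_mono_set _ ?_))
        (h u g₁ g₂ M h1 h2 hM hu hg₁ hg₂)⟩
    exact Set.inter_subset_inter_right S hst
  -- `RhoEmbeds` passes to subsets and to unions, the constants adding, so local validity on the
  -- compact closure gives global validity.
  have h := hc.induction_on (p := RhoEmbeds S) ⟨0, le_rfl, by simp⟩ mono ?_ ?_
  · obtain ⟨K, hK, h⟩ := h
    refine ⟨K, hK, ?_⟩
    rw [Set.inter_eq_left.2 (subset_closure (s := S))] at h
    rwa [Set.inter_univ]
  · rintro s t ⟨K, hK, h⟩ ⟨K', hK', h'⟩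
    refine ⟨K + K', by positivity, fun u g₁ g₂ M h1 h2 hM hu hg₁ hg₂ => ?_⟩
    rw [Set.inter_union_distrib_left, add_mul,
      ENNReal.ofReal_add (by positivity) (by positivity)]
    exact (eLpNorm_restrict_union_le _ _ _).trans (add_le_add
      (h u g₁ g₂ M h1 h2 hM hu hg₁ hg₂) (h' u g₁ g₂ M h1 h2 hM hu hg₁ hg₂))
  · intro x hx
    obtain ⟨N, hN, h⟩ := exists_rhoEmbeds_nhds hS hpos hx
    exact ⟨N, mem_nhdsWithin_of_mem_nhds hN, h⟩

variable {S : Set (ℝ × ℝ)} {μ : Measure (ℝ × ℝ)}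

/-! ### Multiplication is distributive -/

theorem mul_add_fn (u v w : Fn S) : u * (v + w) = u * v + u * w := by
  refine AEEqFun.ext ?_
  filter_upwards [AEEqFun.coeFn_mul u (v + w), AEEqFun.coeFn_add v w,
    AEEqFun.coeFn_add (u * v) (u * w), AEEqFun.coeFn_mul u v, AEEqFun.coeFn_mul u w]
    with p h1 h2 h3 h4 h5
  rw [h1, h3, Pi.mul_apply, h2, Pi.add_apply, Pi.add_apply, h4, h5, Pi.mul_apply, Pi.mul_apply,
    mul_add]

theorem mul_zero_fn (u : Fn S) : u * 0 = 0 := by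
  simpa using mul_smul_fn 0 u 0

theorem mul_neg_fn (u v : Fn S) : u * -v = -(u * v) := by
  simpa using mul_smul_fn (-1) u v

theorem mul_sub_fn (u v w : Fn S) : u * (v - w) = u * v - u * w := by
  rw [sub_eq_add_neg, mul_add_fn, mul_neg_fn, ← sub_eq_add_neg]

/-! ### Bounds in `L²` -/

/-- `u ∈ L²(μ)` with norm at most `M`. -/
structure L2Bdd (μ : Measure (ℝ × ℝ)) (u : Fn S) (M : ℝ) : Prop where
  memLp : MemLp u 2 μ
  norm_le : l2Norm μ u ≤ M

theorem l2Norm_nonneg (u : Fn S) : 0 ≤ l2Norm μ u := ENNReal.toReal_nonneg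

theorem L2Bdd.nonneg {u : Fn S} {M : ℝ} (h : L2Bdd μ u M) : 0 ≤ M :=
  (l2Norm_nonneg u).trans h.norm_le

theorem L2Bdd.mono {u : Fn S} {M M' : ℝ} (h : L2Bdd μ u M) (hM : M ≤ M') : L2Bdd μ u M' :=
  ⟨h.memLp, h.norm_le.trans hM⟩

theorem L2Bdd.eLpNorm_le {u : Fn S} {M : ℝ} (h : L2Bdd μ u M) :
    eLpNorm u 2 μ ≤ ENNReal.ofReal M :=
  ENNReal.le_ofReal_iff_toReal_le h.memLp.eLpNorm_ne_top h.nonneg |>.2 h.norm_le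

theorem L2Bdd.of_eLpNorm_le (hμ : μ ≪ volume.restrict S) {u : Fn S} {M : ℝ} (hM : 0 ≤ M)
    (h : eLpNorm u 2 μ ≤ ENNReal.ofReal M) : L2Bdd μ u M :=
  ⟨⟨u.aestronglyMeasurable.mono_ac hμ, h.trans_lt ENNReal.ofReal_lt_top⟩,
    ENNReal.toReal_le_of_le_ofReal hM h⟩

theorem L2Bdd.add (hμ : μ ≪ volume.restrict S) {u v : Fn S} {M M' : ℝ} (hu : L2Bdd μ u M)
    (hv : L2Bdd μ v M') : L2Bdd μ (u + v) (M + M') := by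
  refine .of_eLpNorm_le hμ (add_nonneg hu.nonneg hv.nonneg) ?_
  rw [eLpNorm_congr_ae (hμ.ae_eq (AEEqFun.coeFn_add u v)),
    ENNReal.ofReal_add hu.nonneg hv.nonneg]
  exact (eLpNorm_add_le hu.memLp.1 hv.memLp.1 (by norm_num)).trans
    (add_le_add hu.eLpNorm_le hv.eLpNorm_le)

theorem L2Bdd.smul (hμ : μ ≪ volume.restrict S) {u : Fn S} {M : ℝ} (c : ℝ)
    (hu : L2Bdd μ u M) : L2Bdd μ (c • u) (|c| * M) := by
  refine .of_eLpNorm_le hμ (mul_nonneg (abs_nonneg c) hu.nonneg) ?_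
  rw [eLpNorm_congr_ae (hμ.ae_eq (AEEqFun.coeFn_smul c u)), eLpNorm_const_smul,
    ENNReal.ofReal_mul (abs_nonneg c), Real.enorm_eq_ofReal_abs]
  gcongr
  exact hu.eLpNorm_le

theorem L2Bdd.neg (hμ : μ ≪ volume.restrict S) {u : Fn S} {M : ℝ} (hu : L2Bdd μ u M) :
    L2Bdd μ (-u) M := by
  simpa using hu.smul hμ (-1)

theorem L2Bdd.sub (hμ : μ ≪ volume.restrict S) {u v : Fn S} {M M' : ℝ} (hu : L2Bdd μ u M)
    (hv : L2Bdd μ v M') : L2Bdd μ (u - v) (M + M') := by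
  rw [sub_eq_add_neg]
  exact hu.add hμ (hv.neg hμ)

theorem coeFn_rho_mul (u : Fn S) :
    ((rho S * u : Fn S) : ℝ × ℝ → ℝ) =ᵐ[volume.restrict S] fun p => p.1 * u p := by
  filter_upwards [AEEqFun.coeFn_mul (rho S) u, AEEqFun.coeFn_mk (μ := volume.restrict S)
    (fun p : ℝ × ℝ => p.1) measurable_fst.aestronglyMeasurable] with p h1 h2
  rw [h1, Pi.mul_apply, rho, h2]

theorem L2Bdd.rho_mul (hS : MeasurableSet S) {R : ℝ} (hR : 0 ≤ R) (h : ∀ p ∈ S, |p.1| ≤ R)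
    {u : Fn S} {M : ℝ} (hu : L2Bdd (cartMeasure S) u M) :
    L2Bdd (cartMeasure S) (rho S * u) (R * M) := by
  refine .of_eLpNorm_le Measure.AbsolutelyContinuous.rfl (mul_nonneg hR hu.nonneg) ?_
  rw [ENNReal.ofReal_mul hR]
  refine (eLpNorm_le_mul_eLpNorm_of_ae_le_mul (c := R) (g := u) ?_ 2).trans ?_
  · filter_upwards [coeFn_rho_mul u, ae_restrict_mem hS] with p h1 h2
    rw [h1, norm_mul]
    gcongr
    exact h p h2
  · gcongr
    exact hu.eLpNorm_le

theorem L2Bdd.toRho (hS : MeasurableSet S) {R : ℝ} (hR : 0 ≤ R) (h : ∀ p ∈ S, |p.1| ≤ R)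
    {u : Fn S} {M : ℝ} (hu : L2Bdd (cartMeasure S) u M) :
    L2Bdd (rhoMeasure S) u (Real.sqrt R * M) := by
  refine .of_eLpNorm_le (rhoMeasure_absolutelyContinuous S)
    (mul_nonneg (Real.sqrt_nonneg R) hu.nonneg) ?_
  rw [ENNReal.ofReal_mul (Real.sqrt_nonneg R)]
  refine (eLpNorm_rho_le hS hR (fun p hp => (le_abs_self _).trans (h p hp)) u).trans ?_
  gcongr
  exact hu.eLpNorm_le

/-! ### Calculus of weak derivatives -/

theorem LocInt.rho_mul {u : Fn S} (hu : LocInt S u) : LocInt S (rho S * u) := by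
  intro k hk hc
  refine ((hu k hk hc).continuousOn_mul (g := fun p : ℝ × ℝ => p.1)
    continuous_fst.continuousOn hc).congr ?_
  exact (ae_restrict_of_ae_restrict_of_subset hk (coeFn_rho_mul u)).mono fun p hp => hp.symm

theorem weakDeriv_eq (hS : IsOpen S) {a b : ℕ} {u g : Fn S} (h : HasWeakDeriv S a b u g) :
    weakDeriv S a b u = g :=
  (Classical.epsilon_spec (p := HasWeakDeriv S a b u) ⟨g, h⟩).unique hS h

theorem weakDiv_eq (hS : IsOpen S) {f : Fin 2 → Fn S} {g : Fn S} (h : HasWeakDiv S f g) :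
    weakDiv S f = g :=
  (Classical.epsilon_spec (p := HasWeakDiv S f) ⟨g, h⟩).unique hS h

theorem HasWeakDeriv.self {u : Fn S} (hu : LocInt S u) : HasWeakDeriv S 0 0 u u :=
  ⟨hu, hu, fun φ _ => by simp⟩

theorem zero_coe_mul (ψ : ℝ × ℝ → ℝ) : ∫ p in S, (0 : Fn S) p * ψ p = 0 := by
  have h := setIntegral_smul_mul (S := S) 0 0 ψ
  rwa [zero_smul, zero_mul] at h

/-- Treating a partial derivative as a divergence lets one product rule with ρ serve both partial
derivatives as well as the divergence and the curl. -/
theorem hasWeakDiv_rho_iff {u g : Fn S} : HasWeakDiv S ![u, 0] g ↔ HasWeakDeriv S 1 0 u g := by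
  have key : (∀ i, LocInt S (![u, 0] i)) → ∀ φ, IsTest S φ →
      ∫ p in S, ((![u, 0] : Fin 2 → Fn S) 0 p * pdRho φ p +
        (![u, 0] : Fin 2 → Fn S) 1 p * pdZ φ p) = ∫ p in S, u p * pdRho φ p := by
    intro h φ hφ
    rw [setIntegral_pair h hφ]
    simp only [Matrix.cons_val_zero, Matrix.cons_val_one, zero_coe_mul, add_zero]
  constructor
  · rintro ⟨h1, h2, h3⟩
    refine ⟨h1 0, h2, fun φ hφ => ?_⟩
    have := h3 φ hφ
    rw [key h1 φ hφ] at this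
    simpa using this
  · rintro ⟨h1, h2, h3⟩
    have h : ∀ i, LocInt S (![u, 0] i) := Fin.forall_fin_two.2 ⟨h1, LocInt.zero⟩
    refine ⟨h, h2, fun φ hφ => ?_⟩
    rw [key h φ hφ]
    simpa using h3 φ hφ

theorem hasWeakDiv_z_iff {u g : Fn S} : HasWeakDiv S ![0, u] g ↔ HasWeakDeriv S 0 1 u g := by
  have key : (∀ i, LocInt S (![0, u] i)) → ∀ φ, IsTest S φ →
      ∫ p in S, ((![0, u] : Fin 2 → Fn S) 0 p * pdRho φ p +
        (![0, u] : Fin 2 → Fn S) 1 p * pdZ φ p) = ∫ p in S, u p * pdZ φ p := by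
    intro h φ hφ
    rw [setIntegral_pair h hφ]
    simp only [Matrix.cons_val_zero, Matrix.cons_val_one, zero_coe_mul, zero_add]
  constructor
  · rintro ⟨h1, h2, h3⟩
    refine ⟨h1 1, h2, fun φ hφ => ?_⟩
    have := h3 φ hφ
    rw [key h1 φ hφ] at this
    simpa using this
  · rintro ⟨h1, h2, h3⟩
    have h : ∀ i, LocInt S (![0, u] i) := Fin.forall_fin_two.2 ⟨LocInt.zero, h1⟩
    refine ⟨h, h2, fun φ hφ => ?_⟩
    rw [key h φ hφ]
    simpa using h3 φ hφ

theorem HasWeakDiv.of_derivs {u v g k : Fn S} (hu : HasWeakDeriv S 1 0 u g)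
    (hv : HasWeakDeriv S 0 1 v k) : HasWeakDiv S ![u, v] (g + k) := by
  simpa using (hasWeakDiv_rho_iff.2 hu).add (hasWeakDiv_z_iff.2 hv)

/-- The product rule `div (ρ f) = ρ div f + f_ρ`. -/
theorem HasWeakDiv.rho_mul {u v g : Fn S} (h : HasWeakDiv S ![u, v] g) :
    HasWeakDiv S ![rho S * u, rho S * v] (rho S * g + u) := by
  have hu : LocInt S u := h.1 0
  have hv : LocInt S v := h.1 1
  have hl : ∀ i, LocInt S (![rho S * u, rho S * v] i) :=
    Fin.forall_fin_two.2 ⟨hu.rho_mul, hv.rho_mul⟩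
  refine ⟨hl, h.2.1.rho_mul.add hu, fun φ hφ => ?_⟩
  -- The weak equation is tested with ρφ; the derivative falling on ρ leaves the extra term u φ.
  have hψ : IsTest S (fun p => p.1 * φ p) :=
    ⟨contDiff_fst.mul hφ.smooth, hφ.compact.mul_left,
      (tsupport_mul_subset_right (f := fun p : ℝ × ℝ => p.1) (g := φ)).trans hφ.supp⟩
  have hd : ∀ p v, fderiv ℝ (fun p : ℝ × ℝ => p.1 * φ p) p v =
      p.1 * fderiv ℝ φ p v + φ p * v.1 := by
    intro p v
    have h1 := (hasFDerivAt_fst (𝕜 := ℝ) (E := ℝ) (F := ℝ) (p := p)).mul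
      ((hφ.smooth.differentiable (by simp)) p).hasFDerivAt
    have h2 : fderiv ℝ (fun p : ℝ × ℝ => p.1 * φ p) p = _ := h1.fderiv
    rw [h2]
    simp
  have e := h.2.2 _ hψ
  have e' : ∫ p in S, ((![u, v] : Fin 2 → Fn S) 0 p * pdRho (fun p => p.1 * φ p) p +
      (![u, v] : Fin 2 → Fn S) 1 p * pdZ (fun p => p.1 * φ p) p) =
      (∫ p in S, ((rho S * u) p * pdRho φ p + (rho S * v) p * pdZ φ p)) +
        ∫ p in S, u p * φ p := by
    have i1 : IntegrableOn (fun p => (rho S * u) p * pdRho φ p + (rho S * v) p * pdZ φ p) S :=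
      (hu.rho_mul.integrable_mul (hφ.pd _)).add (hv.rho_mul.integrable_mul (hφ.pd _))
    rw [← integral_add i1 (hu.integrable_mul hφ)]
    refine integral_congr_ae ?_
    filter_upwards [coeFn_rho_mul u, coeFn_rho_mul v] with p h1 h2
    simp only [pdRho, pdZ, hd, Matrix.cons_val_zero, Matrix.cons_val_one, h1, h2]
    ring
  have e2 : ∫ p in S, g p * (p.1 * φ p) = ∫ p in S, (rho S * g) p * φ p := by
    refine integral_congr_ae ?_
    filter_upwards [coeFn_rho_mul g] with p h1
    rw [h1]
    ring
  rw [e', e2] at e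
  rw [setIntegral_add_mul h.2.1.rho_mul hu hφ]
  simp only [Matrix.cons_val_zero, Matrix.cons_val_one]
  linarith

theorem HasWeakDeriv.rho_mul_rho {u g : Fn S} (h : HasWeakDeriv S 1 0 u g) :
    HasWeakDeriv S 1 0 (rho S * u) (rho S * g + u) := by
  have := (hasWeakDiv_rho_iff.2 h).rho_mul
  rw [mul_zero_fn] at this
  exact hasWeakDiv_rho_iff.1 this

theorem HasWeakDeriv.rho_mul_z {u g : Fn S} (h : HasWeakDeriv S 0 1 u g) :
    HasWeakDeriv S 0 1 (rho S * u) (rho S * g) := by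
  have := (hasWeakDiv_z_iff.2 h).rho_mul
  rw [mul_zero_fn, add_zero] at this
  exact hasWeakDiv_z_iff.1 this

theorem pdZ_pdRho_comm {φ : ℝ × ℝ → ℝ} (hφ : IsTest S φ) : pdZ (pdRho φ) = pdRho (pdZ φ) := by
  ext p
  have hd : DifferentiableAt ℝ (fderiv ℝ φ) p :=
    ((hφ.smooth.fderiv_right (m := 1) (by norm_cast)).differentiable one_ne_zero) p
  have hsymm := (hφ.smooth.contDiffAt (x := p)).isSymmSndFDerivAt
    (by rw [minSmoothness_of_isRCLikeNormedField]; norm_cast)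
  have hv : ∀ v w, fderiv ℝ (fun q => fderiv ℝ φ q v) p w = fderiv ℝ (fderiv ℝ φ) p w v := by
    intro v w
    rw [fderiv_clm_apply hd (differentiableAt_const v)]
    simp
  exact (hv _ _).trans ((hsymm _ _).trans (hv _ _).symm)

theorem pdZ_iterate_pdRho_comm {φ : ℝ × ℝ → ℝ} (hφ : IsTest S φ) (b : ℕ) :
    pdZ^[b] (pdRho φ) = pdRho (pdZ^[b] φ) := by
  induction b with
  | zero => rfl
  | succ b ih =>
    rw [Function.iterate_succ_apply', ih, pdZ_pdRho_comm (φ := pdZ^[b] φ) (hφ.iter 0 b),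
      Function.iterate_succ_apply']

theorem pdZ_iterate_pdRho_iterate_comm {φ : ℝ × ℝ → ℝ} (hφ : IsTest S φ) (b c : ℕ) :
    pdZ^[b] (pdRho^[c] φ) = pdRho^[c] (pdZ^[b] φ) := by
  induction c with
  | zero => rfl
  | succ c ih =>
    rw [Function.iterate_succ_apply', pdZ_iterate_pdRho_comm (φ := pdRho^[c] φ) (hφ.iter c 0), ih,
      Function.iterate_succ_apply']

/-- A derivative of a test function is a test function, so the equation for g may be tested with
∂_ρ^c ∂_z^d φ. Symmetry of mixed derivatives of φ then gives the equation for k. -/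
theorem HasWeakDeriv.of_add {a b c d : ℕ} {u g k : Fn S} (hg : HasWeakDeriv S a b u g)
    (hk : HasWeakDeriv S (a + c) (b + d) u k) : HasWeakDeriv S c d g k := by
  refine ⟨hg.2.1, hk.2.1, fun φ hφ => ?_⟩
  have h1 := hg.2.2 _ (hφ.iter c d)
  have h2 := hk.2.2 φ hφ
  rw [pdZ_iterate_pdRho_iterate_comm (φ := pdZ^[d] φ) (hφ.iter 0 d),
    ← Function.iterate_add_apply, ← Function.iterate_add_apply, h2] at h1
  have hsq : ((-1 : ℝ) ^ (a + b)) * (-1) ^ (a + b) = 1 := by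
    rw [← mul_pow]; norm_num
  have e : (-1 : ℝ) ^ (a + c + (b + d)) = (-1) ^ (a + b) * (-1) ^ (c + d) := by
    rw [← pow_add]; congr 1; omega
  rw [e] at h1
  linear_combination (-(-1 : ℝ) ^ (a + b)) * h1 +
    ((-1) ^ (c + d) * (∫ p in S, k p * φ p) - ∫ p in S, g p * pdRho^[c] (pdZ^[d] φ) p) * hsq

/-! ### Bounds in Sobolev spaces -/

/-- The weak derivatives of `u` of order at most `s` have `L²(μ)` norm at most `M`. -/
def SobBdd (S : Set (ℝ × ℝ)) (μ : Measure (ℝ × ℝ)) (s : ℕ) (u : Fn S) (M : ℝ) : Prop :=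
  ∀ a b : ℕ, a + b ≤ s → ∃ g, HasWeakDeriv S a b u g ∧ L2Bdd μ g M

theorem SobBdd.memSob {s : ℕ} {u : Fn S} {M : ℝ} (h : SobBdd S μ s u M) : MemSob S μ s u :=
  fun a b hab => (h a b hab).imp fun _ hg => ⟨hg.1, hg.2.memLp⟩

theorem SobBdd.mono {s t : ℕ} {u : Fn S} {M M' : ℝ} (h : SobBdd S μ s u M) (hts : t ≤ s)
    (hM : M ≤ M') : SobBdd S μ t u M' :=
  fun a b hab => (h a b (hab.trans hts)).imp fun _ hg => ⟨hg.1, hg.2.mono hM⟩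

theorem sobNorm_nonneg (s : ℕ) (u : Fn S) : 0 ≤ sobNorm S μ s u := Real.sqrt_nonneg _

theorem sobNormVec_nonneg (s : ℕ) {n : ℕ} (u : Fin n → Fn S) : 0 ≤ sobNormVec S μ s u :=
  Real.sqrt_nonneg _

theorem l2Norm_weakDeriv_le_sobNorm {a b s : ℕ} (hab : a + b ≤ s) (u : Fn S) :
    l2Norm μ (weakDeriv S a b u) ≤ sobNorm S μ s u := by
  refine Real.le_sqrt_of_sq_le ?_
  refine le_trans ?_ (Finset.single_le_sum
    (f := fun k => ∑ α ∈ Finset.HasAntidiagonal.antidiagonal k,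
      l2Norm μ (weakDeriv S α.1 α.2 u) ^ 2)
    (fun k _ => Finset.sum_nonneg fun α _ => sq_nonneg _)
    (Finset.mem_range.2 (Nat.lt_succ_of_le hab)))
  exact Finset.single_le_sum (f := fun α : ℕ × ℕ => l2Norm μ (weakDeriv S α.1 α.2 u) ^ 2)
    (fun α _ => sq_nonneg _)
    (a := (a, b)) (Finset.HasAntidiagonal.mem_antidiagonal.2 rfl)

theorem sobNorm_le_sobNormVec (s : ℕ) {n : ℕ} (u : Fin n → Fn S) (i : Fin n) :
    sobNorm S μ s (u i) ≤ sobNormVec S μ s u :=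
  Real.le_sqrt_of_sq_le (Finset.single_le_sum (f := fun i => sobNorm S μ s (u i) ^ 2)
    (fun _ _ => sq_nonneg _) (Finset.mem_univ i))

theorem MemSob.sobBdd (hS : IsOpen S) {s : ℕ} {u : Fn S} (h : MemSob S μ s u) :
    SobBdd S μ s u (sobNorm S μ s u) := fun a b hab => by
  obtain ⟨g, hg, hg'⟩ := h a b hab
  refine ⟨g, hg, hg', ?_⟩
  rw [← weakDeriv_eq hS hg]
  exact l2Norm_weakDeriv_le_sobNorm hab u

/-- The square root of the number of derivatives of order at most `s`. -/
noncomputable def sobCount (s : ℕ) : ℝ :=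
  Real.sqrt (∑ k ∈ Finset.range (s + 1), ((k : ℝ) + 1))

theorem sobCount_nonneg (s : ℕ) : 0 ≤ sobCount s := Real.sqrt_nonneg _

theorem SobBdd.sobNorm_le (hS : IsOpen S) {s : ℕ} {u : Fn S} {M : ℝ} (h : SobBdd S μ s u M) :
    sobNorm S μ s u ≤ sobCount s * M := by
  have hM : 0 ≤ M := by
    obtain ⟨g, _, hg⟩ := h 0 0 (Nat.zero_le s)
    exact hg.nonneg
  refine Real.sqrt_le_iff.2 ⟨mul_nonneg (sobCount_nonneg s) hM, ?_⟩
  rw [mul_pow, sobCount, Real.sq_sqrt (Finset.sum_nonneg fun k _ => by positivity),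
    Finset.sum_mul]
  refine Finset.sum_le_sum fun k hk => ?_
  have : ((k : ℝ) + 1) * M ^ 2 =
      ∑ _α ∈ Finset.HasAntidiagonal.antidiagonal k, M ^ 2 := by
    rw [Finset.sum_const, Finset.Nat.card_antidiagonal, nsmul_eq_mul]
    push_cast
    ring
  rw [this]
  refine Finset.sum_le_sum fun α hα => ?_
  obtain ⟨g, hg, hg'⟩ := h α.1 α.2
    ((Finset.HasAntidiagonal.mem_antidiagonal.1 hα).le.trans (Nat.lt_succ_iff.1 (Finset.mem_range.1 hk)))
  rw [weakDeriv_eq hS hg]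
  exact pow_le_pow_left₀ (l2Norm_nonneg g) hg'.norm_le 2

theorem SobBdd.add (hμ : μ ≪ volume.restrict S) {s : ℕ} {u v : Fn S} {M M' : ℝ}
    (hu : SobBdd S μ s u M) (hv : SobBdd S μ s v M') : SobBdd S μ s (u + v) (M + M') :=
  fun a b hab => by
    obtain ⟨g, hg, hg'⟩ := hu a b hab
    obtain ⟨k, hk, hk'⟩ := hv a b hab
    exact ⟨g + k, hg.add hk, hg'.add hμ hk'⟩

theorem SobBdd.neg (hμ : μ ≪ volume.restrict S) {s : ℕ} {u : Fn S} {M : ℝ}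
    (hu : SobBdd S μ s u M) : SobBdd S μ s (-u) M := fun a b hab => by
  obtain ⟨g, hg, hg'⟩ := hu a b hab
  exact ⟨-g, by simpa using hg.smul (-1), hg'.neg hμ⟩

theorem SobBdd.of_hasWeakDeriv {s c d : ℕ} {u g : Fn S} {M : ℝ}
    (h : SobBdd S μ (s + (c + d)) u M) (hg : HasWeakDeriv S c d u g) : SobBdd S μ s g M :=
  fun a b hab => by
    obtain ⟨k, hk, hk'⟩ := h (c + a) (d + b) (by omega)
    exact ⟨k, hg.of_add hk, hk'⟩

theorem SobBdd.l2Bdd (hS : IsOpen S) {s : ℕ} {u : Fn S} {M : ℝ} (h : SobBdd S μ s u M) :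
    L2Bdd μ u M := by
  obtain ⟨g, hg, hbdd⟩ := h 0 0 (Nat.zero_le s)
  rwa [hg.unique hS (HasWeakDeriv.self hg.1)] at hbdd

/-- `H_ρ^{s+1}(S)` is continuously embedded in `H^s(S)`. -/
theorem exists_sobBdd_cart (hS : IsBoundedLipschitzDomain S) (hpos : ∀ p ∈ S, 0 < p.1) :
    ∃ K : ℝ, 0 ≤ K ∧ ∀ (s : ℕ) (u : Fn S) (M : ℝ), SobBdd S (rhoMeasure S) (s + 1) u M →
      SobBdd S (cartMeasure S) s u (K * M) := by
  obtain ⟨K, hK, h⟩ := rhoEmbeds_univ hS hpos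
  refine ⟨K, hK, fun s u M hu a b hab => ?_⟩
  obtain ⟨g, hg, hg'⟩ := hu a b (by omega)
  obtain ⟨g₁, hg₁, hg₁'⟩ := hu (a + 1) (b + 0) (by omega)
  obtain ⟨g₂, hg₂, hg₂'⟩ := hu (a + 0) (b + 1) (by omega)
  -- The order-one embedding is applied to each derivative g of order at most s; its own first
  -- derivatives are derivatives of u of order at most s + 1.
  have := h g g₁ g₂ M (hg.of_add hg₁) (hg.of_add hg₂) hg'.nonneg hg'.eLpNorm_le
    hg₁'.eLpNorm_le hg₂'.eLpNorm_le
  rw [Set.inter_univ] at this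
  exact ⟨g, hg, .of_eLpNorm_le Measure.AbsolutelyContinuous.rfl
    (mul_nonneg hK hg'.nonneg) this⟩

/-! ### Errors in the Cartesian and in the cylindrical norms -/

theorem sqrt_sum_sq_le {ι : Type*} (s : Finset ι) {x : ι → ℝ} (hx : ∀ i ∈ s, 0 ≤ x i) :
    Real.sqrt (∑ i ∈ s, x i ^ 2) ≤ ∑ i ∈ s, x i :=
  Real.sqrt_le_iff.2 ⟨Finset.sum_nonneg hx, Finset.sum_sq_le_sq_sum_of_nonneg hx⟩

theorem sqrt_sq_add_sq_le {x y : ℝ} (hx : 0 ≤ x) (hy : 0 ≤ y) :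
    Real.sqrt (x ^ 2 + y ^ 2) ≤ x + y :=
  Real.sqrt_le_iff.2 ⟨add_nonneg hx hy, by nlinarith [mul_nonneg hx hy]⟩

theorem l2NormVec_nonneg {n : ℕ} (u : Fin n → Fn S) : 0 ≤ l2NormVec μ u := Real.sqrt_nonneg _

theorem l2NormVec_le {n : ℕ} (u : Fin n → Fn S) : l2NormVec μ u ≤ ∑ i, l2Norm μ (u i) :=
  sqrt_sum_sq_le _ fun i _ => l2Norm_nonneg (u i)

theorem l2Norm_le_l2NormVec {n : ℕ} (u : Fin n → Fn S) (i : Fin n) :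
    l2Norm μ (u i) ≤ l2NormVec μ u :=
  Real.le_sqrt_of_sq_le (Finset.single_le_sum (f := fun i => l2Norm μ (u i) ^ 2)
    (fun _ _ => sq_nonneg _) (Finset.mem_univ i))

theorem l2Bdd_of_mem_H1 (hS : IsOpen S) {e : Fn S} (he : e ∈ H1 S) {E : ℝ}
    (hE : sobNorm S (cartMeasure S) 1 e ≤ E) : L2Bdd (cartMeasure S) e E ∧
      (∃ g, HasWeakDeriv S 1 0 e g ∧ L2Bdd (cartMeasure S) g E) ∧
      ∃ g, HasWeakDeriv S 0 1 e g ∧ L2Bdd (cartMeasure S) g E := by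
  have h : SobBdd S (cartMeasure S) 1 e E := (MemSob.sobBdd hS he).mono le_rfl hE
  exact ⟨h.l2Bdd hS, h 1 0 le_rfl, h 0 1 le_rfl⟩

theorem l2Bdd_of_mem_Hdiv (hS : IsOpen S) {v : Fin 2 → Fn S} (hv : v ∈ Hdiv S) {E : ℝ}
    (hE : hDivNorm S v ≤ E) : (∀ i, L2Bdd (cartMeasure S) (v i) E) ∧
      ∃ g, HasWeakDiv S ![v 0, v 1] g ∧ L2Bdd (cartMeasure S) g E := by
  obtain ⟨hv, g, hg, hg'⟩ := hv
  have h1 : l2NormVec (cartMeasure S) v ≤ E := le_trans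
    (Real.le_sqrt_of_sq_le (le_add_of_nonneg_right (sq_nonneg _))) hE
  have h2 : l2Norm (cartMeasure S) (weakDiv S v) ≤ E := le_trans
    (Real.le_sqrt_of_sq_le (le_add_of_nonneg_left (sq_nonneg _))) hE
  refine ⟨fun i => ⟨hv i, (l2Norm_le_l2NormVec v i).trans h1⟩, g, ?_, hg', ?_⟩
  · convert hg using 1
    ext1 i
    fin_cases i <;> rfl
  · rwa [weakDiv_eq hS hg] at h2

theorem l2Bdd_of_mem_Hcurl (hS : IsOpen S) {v : Fin 2 → Fn S} (hv : v ∈ Hcurl S) {E : ℝ}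
    (hE : hCurlNorm S v ≤ E) : (∀ i, L2Bdd (cartMeasure S) (v i) E) ∧
      ∃ g, HasWeakDiv S ![v 1, - v 0] g ∧ L2Bdd (cartMeasure S) g E := by
  obtain ⟨hv, g, hg, hg'⟩ := hv
  have h1 : l2NormVec (cartMeasure S) v ≤ E := le_trans
    (Real.le_sqrt_of_sq_le (le_add_of_nonneg_right (sq_nonneg _))) hE
  have h2 : l2Norm (cartMeasure S) (weakCurl S v) ≤ E := le_trans
    (Real.le_sqrt_of_sq_le (le_add_of_nonneg_left (sq_nonneg _))) hE
  refine ⟨fun i => ⟨hv i, (l2Norm_le_l2NormVec v i).trans h1⟩, g, hg, hg', ?_⟩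
  rwa [weakCurl, weakDiv_eq hS hg] at h2

/-- The factor ρ in η⁻¹ cancels the 1/ρ in the azimuthal component, which becomes -e; the other
components follow from the product rule. The constant adds up the bounds of the separate components,
as in the two analogues for curl^m and div^m. -/
theorem exists_hGradMNorm_etaInv0_le (hS : IsOpen S) {R : ℝ} (hR : 0 ≤ R)
    (hSR : ∀ p ∈ S, |p.1| ≤ R) (hpos : ∀ p ∈ S, 0 < p.1) {m : ℤ} (hm : m ≠ 0) :
    ∃ A : ℝ, 0 ≤ A ∧ ∀ (e : Fn S) (E : ℝ), e ∈ H1 S → sobNorm S (cartMeasure S) 1 e ≤ E →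
      etaInv0 S m e ∈ HgradM S m ∧ hGradMNorm S m (etaInv0 S m e) ≤ A * E := by
  have hm' : (m : ℝ) ≠ 0 := Int.cast_ne_zero.2 hm
  have ac : cartMeasure S ≪ volume.restrict S := Measure.AbsolutelyContinuous.rfl
  set q := |(m : ℝ)⁻¹| with hq
  refine ⟨Real.sqrt R * (q * R) + (Real.sqrt R * (q * (R + 1)) + Real.sqrt R * (q * R) +
    Real.sqrt R), by positivity, fun e E he hE => ?_⟩
  obtain ⟨b0, ⟨g₁, d1, b1⟩, g₂, d2, b2⟩ := l2Bdd_of_mem_H1 hS he hE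
  have hSm := hS.measurableSet
  have D1 : HasWeakDeriv S 1 0 (etaInv0 S m e) _ := d1.rho_mul_rho.smul (m : ℝ)⁻¹
  have D2 : HasWeakDeriv S 0 1 (etaInv0 S m e) _ := d2.rho_mul_z.smul (m : ℝ)⁻¹
  have B0 : L2Bdd (rhoMeasure S) (etaInv0 S m e) _ :=
    ((b0.rho_mul hSm hR hSR).smul ac (m : ℝ)⁻¹).toRho hSm hR hSR
  have B1 := (((b1.rho_mul hSm hR hSR).add ac b0).smul ac (m : ℝ)⁻¹).toRho hSm hR hSR
  have B2 := ((b2.rho_mul hSm hR hSR).smul ac (m : ℝ)⁻¹).toRho hSm hR hSR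
  have B3 := (b0.neg ac).toRho hSm hR hSR
  have hgrad : gradM S m (etaInv0 S m e) =
      ![(m : ℝ)⁻¹ • (rho S * g₁ + e), (m : ℝ)⁻¹ • (rho S * g₂), -e] := by
    rw [gradM, weakDeriv_eq hS D1, weakDeriv_eq hS D2, etaInv0, mul_smul_fn,
      rhoInv_mul_rho_mul hSm hpos, smul_inv_smul₀ hm']
  refine ⟨⟨B0.memLp, ⟨_, D1⟩, ⟨_, D2⟩, ?_⟩, ?_⟩
  · rw [hgrad]
    intro i
    fin_cases i
    exacts [B1.memLp, B2.memLp, B3.memLp]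
  · refine (sqrt_sq_add_sq_le (l2Norm_nonneg _) (l2NormVec_nonneg _)).trans ?_
    refine (add_le_add B0.norm_le (l2NormVec_le _)).trans ?_
    rw [hgrad, Fin.sum_univ_three]
    refine (add_le_add le_rfl (add_le_add (add_le_add B1.norm_le B2.norm_le) B3.norm_le)).trans
      (le_of_eq ?_)
    ring

/-- The critical component is (1/ρ)(∂_ρ(ρ u_θ) + m u_ρ): the product rule yields a term w, and m u_ρ
= ρ v_ρ - w removes it, leaving ρ times an L² function. -/
theorem exists_hCurlMNorm_etaInv1_le (hS : IsOpen S) {R : ℝ} (hR : 0 ≤ R)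
    (hSR : ∀ p ∈ S, |p.1| ≤ R) (hpos : ∀ p ∈ S, 0 < p.1) {m : ℤ} (hm : m ≠ 0) :
    ∃ A : ℝ, 0 ≤ A ∧ ∀ (v : Fin 2 → Fn S) (w : Fn S) (E : ℝ), v ∈ Hcurl S → w ∈ H1 S →
      hCurlNorm S v ≤ E → sobNorm S (cartMeasure S) 1 w ≤ E →
      etaInv1 S m (joinField v w) ∈ HcurlM S m ∧
        hCurlMNorm S m (etaInv1 S m (joinField v w)) ≤ A * E := by
  have hm' : (m : ℝ) ≠ 0 := Int.cast_ne_zero.2 hm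
  have ac : cartMeasure S ≪ volume.restrict S := Measure.AbsolutelyContinuous.rfl
  set q := |(m : ℝ)⁻¹| with hq
  refine ⟨Real.sqrt R * (q * (R + 1)) + Real.sqrt R * (q * R) + Real.sqrt R +
    (Real.sqrt R * 2 + Real.sqrt R * 2 + Real.sqrt R * (q * (R + 2))), by positivity,
    fun v w E hv hw hvE hwE => ?_⟩
  obtain ⟨b, c, dc, bc⟩ := l2Bdd_of_mem_Hcurl hS hv hvE
  obtain ⟨b0, ⟨g₁, d1, b1⟩, g₂, d2, b2⟩ := l2Bdd_of_mem_H1 hS hw hwE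
  have hSm := hS.measurableSet
  have hu : etaInv1 S m (joinField v w) =
      ![(m : ℝ)⁻¹ • (rho S * v 0 - w), (m : ℝ)⁻¹ • (rho S * v 1), w] := rfl
  set u := etaInv1 S m (joinField v w) with hudef
  have u0 : u 0 = (m : ℝ)⁻¹ • (rho S * v 0 - w) := by rw [hu]; rfl
  have u1 : u 1 = (m : ℝ)⁻¹ • (rho S * v 1) := by rw [hu]; rfl
  have u2 : u 2 = w := by rw [hu]; rfl
  have D1 : HasWeakDeriv S 1 0 (rho S * u 2) (rho S * g₁ + w) := by
    rw [u2]; exact d1.rho_mul_rho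
  have D2 : HasWeakDeriv S 0 1 (u 2) g₂ := by rwa [u2]
  have D3 : HasWeakDiv S ![- u 1, u 0] ((m : ℝ)⁻¹ • -(rho S * c + v 1 + g₂)) := by
    -- The rotated field (-u_z, u_ρ) equals -(1/m)(ρ (v_z, -v_ρ) + (0, w)), whose divergence is
    -- known from the curl of v and from ∂_z w.
    have := (dc.rho_mul.add (hasWeakDiv_z_iff.2 d2)).smul (-(m : ℝ)⁻¹)
    convert this using 1
    · ext1 i
      fin_cases i
      · simp [u1]
      · simp only [Fin.mk_one, Matrix.cons_val_one, u0, Pi.smul_apply, Pi.add_apply,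
          Matrix.cons_val_fin_one, mul_neg_fn]
        module
    · module
  have B0 := (((b 0).rho_mul hSm hR hSR).sub ac b0).smul ac (m : ℝ)⁻¹ |>.toRho hSm hR hSR
  have B1 := (((b 1).rho_mul hSm hR hSR).smul ac (m : ℝ)⁻¹).toRho hSm hR hSR
  have B2 := b0.toRho hSm hR hSR
  have C0 := ((b 1).add ac b2).neg ac |>.toRho hSm hR hSR
  have C1 := (b1.add ac (b 0)).toRho hSm hR hSR
  have C2 := ((((bc.rho_mul hSm hR hSR).add ac (b 1)).add ac b2).neg ac).smul ac (m : ℝ)⁻¹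
    |>.toRho hSm hR hSR
  have hcurl : curlM S m u =
      ![-(v 1 + g₂), g₁ + v 0, (m : ℝ)⁻¹ • -(rho S * c + v 1 + g₂)] := by
    rw [curlM, weakDeriv_eq hS D1, weakDeriv_eq hS D2, weakDiv_eq hS D3]
    congr 1
    · rw [u1, mul_smul_fn, rhoInv_mul_rho_mul hSm hpos, smul_inv_smul₀ hm']
      abel
    · congr 1
      rw [u0, smul_inv_smul₀ hm', show rho S * g₁ + w + (rho S * v 0 - w) =
        rho S * g₁ + rho S * v 0 by abel, ← mul_add_fn, rhoInv_mul_rho_mul hSm hpos]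
  refine ⟨⟨?_, ⟨_, D2⟩, ⟨_, D1⟩, ⟨_, D3⟩, ?_⟩, ?_⟩
  · rw [hu]
    intro i
    fin_cases i
    exacts [B0.memLp, B1.memLp, B2.memLp]
  · rw [hcurl]
    intro i
    fin_cases i
    exacts [C0.memLp, C1.memLp, C2.memLp]
  · refine (sqrt_sq_add_sq_le (l2NormVec_nonneg _) (l2NormVec_nonneg _)).trans ?_
    refine (add_le_add (l2NormVec_le _) (l2NormVec_le _)).trans ?_
    rw [hcurl, hu, Fin.sum_univ_three, Fin.sum_univ_three]
    refine (add_le_add (add_le_add (add_le_add B0.norm_le B1.norm_le) B2.norm_le)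
      (add_le_add (add_le_add C0.norm_le C1.norm_le) C2.norm_le)).trans (le_of_eq ?_)
    ring

/-- The singular terms v_ρ/ρ from the product rule and from u_θ = (ρ w + v_ρ)/m cancel, so the
cylindrical divergence is just div v - w. -/
theorem exists_hDivMNorm_etaInv2_le (hS : IsOpen S) {R : ℝ} (hR : 0 ≤ R)
    (hSR : ∀ p ∈ S, |p.1| ≤ R) (hpos : ∀ p ∈ S, 0 < p.1) {m : ℤ} (hm : m ≠ 0) :
    ∃ A : ℝ, 0 ≤ A ∧ ∀ (v : Fin 2 → Fn S) (w : Fn S) (E : ℝ), v ∈ Hdiv S →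
      hDivNorm S v ≤ E → L2Bdd (cartMeasure S) w E →
      etaInv2 S m (joinField v w) ∈ HdivM S m ∧
        hDivMNorm S m (etaInv2 S m (joinField v w)) ≤ A * E := by
  have hm' : (m : ℝ) ≠ 0 := Int.cast_ne_zero.2 hm
  have ac : cartMeasure S ≪ volume.restrict S := Measure.AbsolutelyContinuous.rfl
  set q := |(m : ℝ)⁻¹| with hq
  refine ⟨Real.sqrt R + Real.sqrt R + Real.sqrt R * (q * (R + 1)) + Real.sqrt R * 2,
    by positivity, fun v w E hv hvE bw => ?_⟩
  obtain ⟨b, c, dc, bc⟩ := l2Bdd_of_mem_Hdiv hS hv hvE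
  have hSm := hS.measurableSet
  have hu : etaInv2 S m (joinField v w) = ![v 0, v 1, (m : ℝ)⁻¹ • (rho S * w + v 0)] := rfl
  set u := etaInv2 S m (joinField v w) with hudef
  have u0 : u 0 = v 0 := by rw [hu]; rfl
  have u1 : u 1 = v 1 := by rw [hu]; rfl
  have u2 : u 2 = (m : ℝ)⁻¹ • (rho S * w + v 0) := by rw [hu]; rfl
  have D : HasWeakDiv S ![rho S * u 0, rho S * u 1] (rho S * c + v 0) := by
    rw [u0, u1]; exact dc.rho_mul
  have B0 := (b 0).toRho hSm hR hSR
  have B1 := (b 1).toRho hSm hR hSR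
  have B2 := ((bw.rho_mul hSm hR hSR).add ac (b 0)).smul ac (m : ℝ)⁻¹ |>.toRho hSm hR hSR
  have C0 := (bc.sub ac bw).toRho hSm hR hSR
  have hdiv : divM S m u = c - w := by
    rw [divM, weakDiv_eq hS D, u2, mul_smul_fn, smul_inv_smul₀ hm', mul_add_fn, mul_add_fn,
      rhoInv_mul_rho_mul hSm hpos, rhoInv_mul_rho_mul hSm hpos]
    abel
  refine ⟨⟨?_, ⟨_, D⟩, ?_⟩, ?_⟩
  · rw [hu]
    intro i
    fin_cases i
    exacts [B0.memLp, B1.memLp, B2.memLp]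
  · rw [hdiv]
    exact C0.memLp
  · refine (sqrt_sq_add_sq_le (l2NormVec_nonneg _) (l2Norm_nonneg _)).trans ?_
    refine (add_le_add (l2NormVec_le _) le_rfl).trans ?_
    rw [hdiv, hu, Fin.sum_univ_three]
    refine (add_le_add (add_le_add (add_le_add B0.norm_le B1.norm_le) B2.norm_le)
      C0.norm_le).trans (le_of_eq ?_)
    ring

/-! ### Regular fields lie in the Cartesian spaces -/

theorem SobBdd.mem_H1 {s : ℕ} {u : Fn S} {M : ℝ} (h : SobBdd S (cartMeasure S) (s + 1) u M) :
    u ∈ H1 S := (h.mono (Nat.le_add_left 1 s) le_rfl).memSob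

theorem SobBdd.exists_weakDiv {s : ℕ} {u v : Fn S} {M : ℝ}
    (hu : SobBdd S (cartMeasure S) (s + 1) u M) (hv : SobBdd S (cartMeasure S) (s + 1) v M) :
    ∃ g, HasWeakDiv S ![u, v] g ∧ SobBdd S (cartMeasure S) s g (M + M) := by
  obtain ⟨g₁, h1, -⟩ := hu 1 0 (by omega)
  obtain ⟨g₂, h2, -⟩ := hv 0 1 (by omega)
  exact ⟨g₁ + g₂, .of_derivs h1 h2,
    (hu.of_hasWeakDeriv (c := 1) (d := 0) h1).add .rfl
      (hv.of_hasWeakDeriv (c := 0) (d := 1) h2)⟩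

theorem sobNormVec_le (s : ℕ) {n : ℕ} (u : Fin n → Fn S) :
    sobNormVec S μ s u ≤ ∑ i, sobNorm S μ s (u i) :=
  sqrt_sum_sq_le _ fun i _ => sobNorm_nonneg s (u i)

/-- One extra order of regularity of v controls its curl in H^s. The factor 4 counts M for each of
the two components and 2M for the curl. -/
theorem SobBdd.mem_Hcurl (hS : IsOpen S) {s : ℕ} {v : Fin 2 → Fn S} {M : ℝ}
    (h : ∀ i, SobBdd S (cartMeasure S) (s + 1) (v i) M) :
    v ∈ Hcurl S ∧ MemHsCurl S s v ∧ hsCurlNorm S s v ≤ 4 * sobCount s * M := by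
  obtain ⟨g, hg, hg'⟩ := (h 1).exists_weakDiv ((h 0).neg .rfl)
  have hs : ∀ i, SobBdd S (cartMeasure S) s (v i) M := fun i =>
    (h i).mono (Nat.le_succ s) le_rfl
  have hc : weakCurl S v = g := weakDiv_eq hS hg
  refine ⟨⟨fun i => ((h i).l2Bdd hS).memLp, g, hg, (hg'.l2Bdd hS).memLp⟩,
    ⟨fun i => (hs i).memSob, hc ▸ hg'.memSob⟩, ?_⟩
  refine (sqrt_sq_add_sq_le (sobNormVec_nonneg _ _) (sobNorm_nonneg _ _)).trans ?_
  refine (add_le_add (sobNormVec_le _ _) le_rfl).trans ?_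
  rw [hc, Fin.sum_univ_two]
  linarith [(hs 0).sobNorm_le hS, (hs 1).sobNorm_le hS, hg'.sobNorm_le hS]

theorem SobBdd.mem_Hdiv (hS : IsOpen S) {s : ℕ} {v : Fin 2 → Fn S} {M : ℝ}
    (h : ∀ i, SobBdd S (cartMeasure S) (s + 1) (v i) M) :
    v ∈ Hdiv S ∧ MemHsDiv S s v ∧ hsDivNorm S s v ≤ 4 * sobCount s * M := by
  obtain ⟨g, hg, hg'⟩ := (h 0).exists_weakDiv (h 1)
  have e : ![v 0, v 1] = v := by
    ext1 i
    fin_cases i <;> rfl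
  rw [e] at hg
  have hs : ∀ i, SobBdd S (cartMeasure S) s (v i) M := fun i =>
    (h i).mono (Nat.le_succ s) le_rfl
  have hc : weakDiv S v = g := weakDiv_eq hS hg
  refine ⟨⟨fun i => ((h i).l2Bdd hS).memLp, g, hg, (hg'.l2Bdd hS).memLp⟩,
    ⟨fun i => (hs i).memSob, hc ▸ hg'.memSob⟩, ?_⟩
  refine (sqrt_sq_add_sq_le (sobNormVec_nonneg _ _) (sobNorm_nonneg _ _)).trans ?_
  refine (add_le_add (sobNormVec_le _ _) le_rfl).trans ?_
  rw [hc, Fin.sum_univ_two]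
  linarith [(hs 0).sobNorm_le hS, (hs 1).sobNorm_le hS, hg'.sobNorm_le hS]

/-! ### The cylindrical errors -/

/-- Writing u = η⁻¹ηu and using linearity of η⁻¹ moves the whole error to the Cartesian side, where
the assumed estimates apply. -/
theorem sub_cylProj0 (hS : MeasurableSet S) (hpos : ∀ p ∈ S, 0 < p.1) {m : ℤ} (hm : m ≠ 0)
    (D : CartesianDiscretization S) (u : ZTilde0 S m) :
    (u : Fn S) - cylProj0 D m u = etaInv0 S m
      (((⟨eta0 S m u, u.2.2⟩ : H1 S) - D.P0 ⟨eta0 S m u, u.2.2⟩ : H1 S) : Fn S) := by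
  conv_lhs => rw [← etaInv0_leftInverse hS hpos hm (u : Fn S)]
  simp only [cylProj0, etaInv0, Submodule.coe_sub, mul_sub_fn, smul_sub]

theorem etaInv1_sub (m : ℤ) (u v : Fin 3 → Fn S) :
    etaInv1 S m u - etaInv1 S m v = etaInv1 S m (u - v) := by
  ext1 i
  fin_cases i
  · change (m : ℝ)⁻¹ • (rho S * u 0 - u 2) - (m : ℝ)⁻¹ • (rho S * v 0 - v 2) =
      (m : ℝ)⁻¹ • (rho S * (u 0 - v 0) - (u 2 - v 2))
    rw [mul_sub_fn]
    module
  · change (m : ℝ)⁻¹ • (rho S * u 1) - (m : ℝ)⁻¹ • (rho S * v 1) =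
      (m : ℝ)⁻¹ • (rho S * (u 1 - v 1))
    rw [mul_sub_fn, smul_sub]
  · rfl

theorem etaInv2_sub (m : ℤ) (u v : Fin 3 → Fn S) :
    etaInv2 S m u - etaInv2 S m v = etaInv2 S m (u - v) := by
  ext1 i
  fin_cases i
  · rfl
  · rfl
  · change (m : ℝ)⁻¹ • (rho S * u 2 + u 0) - (m : ℝ)⁻¹ • (rho S * v 2 + v 0) =
      (m : ℝ)⁻¹ • (rho S * (u 2 - v 2) + (u 0 - v 0))
    rw [mul_sub_fn]
    module

theorem sub_joinField (u : Fin 3 → Fn S) (v : Fin 2 → Fn S) (w : Fn S) :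
    u - joinField v w = joinField (mer u - v) (u 2 - w) := by
  ext1 i
  fin_cases i <;> rfl

theorem sub_cylProj1 (hS : MeasurableSet S) (hpos : ∀ p ∈ S, 0 < p.1) {m : ℤ} (hm : m ≠ 0)
    (D : CartesianDiscretization S) (u : ZTilde1 S m) :
    (u : Fin 3 → Fn S) - cylProj1 D m u = etaInv1 S m (joinField
      (((⟨mer (eta1 S m u), u.2.2.1⟩ : Hcurl S) - D.P1 ⟨mer (eta1 S m u), u.2.2.1⟩ : Hcurl S) :
        Fin 2 → Fn S)
      (((⟨eta1 S m u 2, u.2.2.2⟩ : H1 S) - D.P0 ⟨eta1 S m u 2, u.2.2.2⟩ : H1 S) : Fn S)) := by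
  conv_lhs => rw [← etaInv1_leftInverse hS hpos hm (u : Fin 3 → Fn S)]
  rw [cylProj1, etaInv1_sub, sub_joinField]
  rfl

theorem sub_cylProj2 (hS : MeasurableSet S) (hpos : ∀ p ∈ S, 0 < p.1) {m : ℤ} (hm : m ≠ 0)
    (D : CartesianDiscretization S) (u : ZTilde2 S m) :
    (u : Fin 3 → Fn S) - cylProj2 D m u = etaInv2 S m (joinField
      (((⟨mer (eta2 S m u), u.2.2.1⟩ : Hdiv S) - D.P1s ⟨mer (eta2 S m u), u.2.2.1⟩ : Hdiv S) :
        Fin 2 → Fn S)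
      (((⟨eta2 S m u 2, u.2.2.2⟩ : L2 S) - D.P2 ⟨eta2 S m u 2, u.2.2.2⟩ : L2 S) : Fn S)) := by
  conv_lhs => rw [← etaInv2_leftInverse hS hpos hm (u : Fin 3 → Fn S)]
  rw [cylProj2, etaInv2_sub, sub_joinField]
  rfl

end Axisym

/-! ### Assembly of the four error estimates -/

theorem mainTheorem2 (S : Set (ℝ × ℝ)) (hS : IsBoundedLipschitzDomain S)
    (hpos : ∀ p ∈ S, 0 < p.1) (m : ℤ) (hm : m ≠ 0) (s : ℕ) (C₀ : ℝ) :
    ∃ C : ℝ, 0 < C ∧ ∀ (D : CartesianDiscretization S) (h : ℝ), 0 < h → D.Estimates s h C₀ →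
      (∀ u ∈ RegGrad S m (s + 2), ∃ hu : u ∈ ZTilde0 S m,
        u - cylProj0 D m ⟨u, hu⟩ ∈ HgradM S m ∧
        hGradMNorm S m (u - cylProj0 D m ⟨u, hu⟩) ≤
          C * h ^ s * (sobNorm S (rhoMeasure S) (s + 2) (eta0 S m u) +
            sobNormVec S (rhoMeasure S) (s + 2) (eta1 S m (gradM S m u)))) ∧
      (∀ u ∈ RegCurl S m (s + 2), ∃ hu : u ∈ ZTilde1 S m,
        u - cylProj1 D m ⟨u, hu⟩ ∈ HcurlM S m ∧
        hCurlMNorm S m (u - cylProj1 D m ⟨u, hu⟩) ≤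
          C * h ^ s * (sobNormVec S (rhoMeasure S) (s + 2) (eta1 S m u) +
            sobNormVec S (rhoMeasure S) (s + 2) (eta2 S m (curlM S m u)))) ∧
      (∀ u ∈ RegDiv S m (s + 2), ∃ hu : u ∈ ZTilde2 S m,
        u - cylProj2 D m ⟨u, hu⟩ ∈ HdivM S m ∧
        hDivMNorm S m (u - cylProj2 D m ⟨u, hu⟩) ≤
          C * h ^ s * (sobNormVec S (rhoMeasure S) (s + 2) (eta2 S m u) +
            sobNorm S (rhoMeasure S) (s + 2) (eta3 S (divM S m u)))) ∧
      (∀ u : Fn S, MemSob S (rhoMeasure S) (s + 2) u → ∃ hu : u ∈ ZTilde3 S,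
        u - cylProj3 D ⟨u, hu⟩ ∈ L2rho S ∧
        l2Norm (rhoMeasure S) (u - cylProj3 D ⟨u, hu⟩) ≤
          C * h ^ s * sobNorm S (rhoMeasure S) (s + 2) u) := by
  obtain ⟨R₀, hR₀⟩ := hS.isBounded.exists_norm_le
  set R := max R₀ 0
  have hR : 0 ≤ R := le_max_right _ _
  have hSR : ∀ p ∈ S, |p.1| ≤ R := fun p hp =>
    (norm_fst_le p).trans ((hR₀ p hp).trans (le_max_left _ _))
  have hSo := hS.isOpen
  have hSm := hSo.measurableSet
  obtain ⟨K, hK, hemb⟩ := exists_sobBdd_cart hS hpos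
  obtain ⟨A₀, hA₀, H₀⟩ := exists_hGradMNorm_etaInv0_le hSo hR hSR hpos hm
  obtain ⟨A₁, hA₁, H₁⟩ := exists_hCurlMNorm_etaInv1_le hSo hR hSR hpos hm
  obtain ⟨A₂, hA₂, H₂⟩ := exists_hDivMNorm_etaInv2_le hSo hR hSR hpos hm
  have hc := sobCount_nonneg s
  have hc1 := sobCount_nonneg (s + 1)
  -- One constant for all Cartesian errors: `sobCount (s + 1)` serves the H¹ estimate, 4 times
  -- `sobCount s` the curl and divergence estimates, and K is the embedding constant. The absolute
  -- value is there because C₀ may be negative.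
  set B := |C₀| * (4 * (sobCount s + sobCount (s + 1)) * K) with hB
  have hB0 : 0 ≤ B := by positivity
  set A := A₀ + A₁ + A₂ + Real.sqrt R with hA
  have hsR := Real.sqrt_nonneg R
  -- A dominates each of the four constants for η⁻¹; the summand 1 only ensures strict positivity.
  refine ⟨A * B + 1, by positivity, fun D h hh hD => ?_⟩
  have hhs : 0 < h ^ s := pow_pos hh s
  -- A Cartesian error is at most `B * h ^ s * M`.
  have herr : ∀ {x X M : ℝ}, x ≤ C₀ * h ^ s * X → 0 ≤ X → 0 ≤ M →
      X ≤ 4 * (sobCount s + sobCount (s + 1)) * (K * M) → x ≤ B * h ^ s * M := by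
    intro x X M hx hX hM hXM
    calc x ≤ C₀ * h ^ s * X := hx
      _ ≤ |C₀| * h ^ s * (4 * (sobCount s + sobCount (s + 1)) * (K * M)) := by
          gcongr
          exact le_abs_self C₀
      _ = B * h ^ s * M := by rw [hB]; ring
  have hfin : ∀ {x a M N : ℝ}, a ≤ A → 0 ≤ M → 0 ≤ N → x ≤ a * (B * h ^ s * M) →
      x ≤ (A * B + 1) * h ^ s * (M + N) := by
    intro x a M N ha hM hN hx
    have hE : 0 ≤ B * h ^ s * M := by positivity
    have hAB : 0 ≤ (A * B + 1) * h ^ s * N := by positivity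
    nlinarith [mul_le_mul_of_nonneg_right ha hE, mul_nonneg hhs.le hM]
  have hb0 : ∀ {w : Fn S} {M : ℝ}, SobBdd S (rhoMeasure S) (s + 2) w M → 0 ≤ M →
      ∀ hw : w ∈ H1 S, sobNorm S (cartMeasure S) 1
        (((⟨w, hw⟩ : H1 S) - D.P0 ⟨w, hw⟩ : H1 S) : Fn S) ≤ B * h ^ s * M := by
    intro w M hwM hM hw
    have hwc := hemb (s + 1) w M hwM
    refine herr (hD.est0 ⟨w, hw⟩ hwc.memSob) (sobNorm_nonneg _ _) hM
      ((hwc.sobNorm_le hSo).trans ?_)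
    nlinarith [mul_nonneg hc (mul_nonneg hK hM), mul_nonneg hc1 (mul_nonneg hK hM)]
  have hb2 : ∀ {w : Fn S} {M : ℝ}, SobBdd S (rhoMeasure S) (s + 2) w M → 0 ≤ M →
      ∀ hw : w ∈ Axisym.L2 S, L2Bdd (cartMeasure S)
        (((⟨w, hw⟩ : Axisym.L2 S) - D.P2 ⟨w, hw⟩ : Axisym.L2 S) : Fn S) (B * h ^ s * M) := by
    intro w M hwM hM hw
    have hwc := (hemb (s + 1) w M hwM).mono (Nat.le_succ s) le_rfl
    refine ⟨(((⟨w, hw⟩ : Axisym.L2 S) - D.P2 ⟨w, hw⟩ : Axisym.L2 S)).2,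
      herr (hD.est2 ⟨w, hw⟩ hwc.memSob) (sobNorm_nonneg _ _) hM
      ((hwc.sobNorm_le hSo).trans ?_)⟩
    nlinarith [mul_nonneg hc (mul_nonneg hK hM), mul_nonneg hc1 (mul_nonneg hK hM)]
  have haux : ∀ {M : ℝ}, 0 ≤ M → 4 * sobCount s * (K * M) ≤
      4 * (sobCount s + sobCount (s + 1)) * (K * M) := by
    intro M hM
    nlinarith [mul_nonneg hc1 (mul_nonneg hK hM)]
  refine ⟨?_, ?_, ?_, ?_⟩
  · rintro u ⟨hu, hu0, -⟩
    have hM := sobNorm_nonneg (μ := rhoMeasure S) (s + 2) (eta0 S m u)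
    have hsob := hu0.sobBdd hSo
    have hZ : u ∈ ZTilde0 S m := ⟨hu, (hemb (s + 1) _ _ hsob).mem_H1⟩
    refine ⟨hZ, ?_⟩
    rw [sub_cylProj0 hSm hpos hm D ⟨u, hZ⟩]
    obtain ⟨h1, h2⟩ := H₀ _ _ (Subtype.prop _) (hb0 hsob hM hZ.2)
    exact ⟨h1, hfin (by linarith) hM (sobNormVec_nonneg _ _) h2⟩
  · rintro u ⟨hu, hu1, -⟩
    have hM := sobNormVec_nonneg (μ := rhoMeasure S) (s + 2) (eta1 S m u)
    have hsob : ∀ i, SobBdd S (rhoMeasure S) (s + 2) (eta1 S m u i) _ := fun i =>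
      ((hu1 i).sobBdd hSo).mono le_rfl (sobNorm_le_sobNormVec _ _ i)
    obtain ⟨hv, hv', hvn⟩ := SobBdd.mem_Hcurl (v := mer (eta1 S m u)) hSo
      (Fin.forall_fin_two.2 ⟨hemb (s + 1) _ _ (hsob 0),
        hemb (s + 1) _ _ (hsob 1)⟩)
    have hZ : u ∈ ZTilde1 S m := ⟨hu, hv, (hemb (s + 1) _ _ (hsob 2)).mem_H1⟩
    refine ⟨hZ, ?_⟩
    rw [sub_cylProj1 hSm hpos hm D ⟨u, hZ⟩]
    obtain ⟨h1, h2⟩ := H₁ _ _ _ (Subtype.prop _) (Subtype.prop _)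
      (herr (hD.est1 ⟨_, hv⟩ hv') (Real.sqrt_nonneg _) hM (hvn.trans (haux hM)))
      (hb0 (hsob 2) hM hZ.2.2)
    exact ⟨h1, hfin (by linarith) hM (sobNormVec_nonneg _ _) h2⟩
  · rintro u ⟨hu, hu2, -⟩
    have hM := sobNormVec_nonneg (μ := rhoMeasure S) (s + 2) (eta2 S m u)
    have hsob : ∀ i, SobBdd S (rhoMeasure S) (s + 2) (eta2 S m u i) _ := fun i =>
      ((hu2 i).sobBdd hSo).mono le_rfl (sobNorm_le_sobNormVec _ _ i)
    obtain ⟨hv, hv', hvn⟩ := SobBdd.mem_Hdiv (v := mer (eta2 S m u)) hSo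
      (Fin.forall_fin_two.2 ⟨hemb (s + 1) _ _ (hsob 0), hemb (s + 1) _ _ (hsob 1)⟩)
    have hZ : u ∈ ZTilde2 S m := ⟨hu, hv, ((hemb (s + 1) _ _ (hsob 2)).l2Bdd hSo).memLp⟩
    refine ⟨hZ, ?_⟩
    rw [sub_cylProj2 hSm hpos hm D ⟨u, hZ⟩]
    obtain ⟨h1, h2⟩ := H₂ _ _ _ (Subtype.prop _)
      (herr (hD.est1s ⟨_, hv⟩ hv') (Real.sqrt_nonneg _) hM (hvn.trans (haux hM)))
      (hb2 (hsob 2) hM hZ.2.2)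
    exact ⟨h1, hfin (by linarith) hM (sobNorm_nonneg _ _) h2⟩
  · intro u hu
    have hM := sobNorm_nonneg (μ := rhoMeasure S) (s + 2) u
    have hsob := hu.sobBdd hSo
    have hZ : u ∈ ZTilde3 S :=
      ⟨(hsob.l2Bdd hSo).memLp, ((hemb (s + 1) _ _ hsob).l2Bdd hSo).memLp⟩
    refine ⟨hZ, ?_⟩
    -- Here η is the identity, and passing to the weighted norm costs only √R.
    have hE := (hb2 hsob hM hZ.2).toRho hSm hR hSR
    refine ⟨hE.memLp, ?_⟩
    have := hfin (by linarith) hM le_rfl hE.norm_le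
    rwa [add_zero] at this
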